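/- Let $\mathbb{B}^n=\{y\in\mathbb{R}^n:|y|\le1\}$, let $(\mathbb{B}^n)^o$ be its interior, and write $\langle z\rangle=\sqrt{1+|z|^2}$. Let $\iota$ denote, on $\mathbb{R}^n$ for $n\in\{d,s\}$, a diffeomorphism $\mathbb{R}^n\to(\mathbb{B}^n)^o$ with $\iota(x)=\frac{x}{|x|}\bigl(1-\frac1{|x|}\bigr)$ for $|x|>3$, and let $h$ be a smooth function $\mathbb{B}^n\to[0,\infty)$ with $h(y)=|y|$ for $2/3<|y|\le1$ and $h(y)\ne1$ for $|y|<2/3$. A smooth function $a$ on $\mathbb{R}^d\times\mathbb{R}^s$ belongs to $\mathrm{SG}^{m_e,m_\psi}$ if $|\partial_\theta^\alpha\partial_x^\beta a(x,\theta)|\le C_{\alpha\beta}\langle x\rangle^{m_e-|\beta|}\langle\theta\rangle^{m_\psi-|\alpha|}$ for all multi-indices $\alpha,\beta$. A $0$-excision function is a smooth function vanishing near the origin and equal to $1$ outside a bounded set. One writes $a\in\mathrm{SG}^{m_e,m_\psi}_{\mathrm{cl}(x)}$ if there are a $0$-excision function $\chi$ and functions $a_j$ $(j\ge0)$, smooth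 on $(\mathbb{R}^d\setminus0)\times\mathbb{R}^s$ and homogeneous of degree $m_e-j$ in $x$, with $a-\sum_{j<N}\chi(x)a_j\in\mathrm{SG}^{m_e-N,m_\psi}$ for all $N\ge0$; $\mathrm{SG}^{m_e,m_\psi}_{\mathrm{cl}(\theta)}$ is defined in the same way with the roles of $(x,m_e)$ and $(\theta,m_\psi)$ exchanged. Finally $a\in\mathrm{SG}^{m_e,m_\psi}_{\mathrm{cl}}$ if $a$ has an expansion of the first kind with $\chi(x)a_j\in\mathrm{SG}^{m_e-j,m_\psi}_{\mathrm{cl}(\theta)}$ for all $j$, and an expansion of the second kind, with terms $\chi(\theta)b_k$ satisfying $\chi(\theta)b_k\in\mathrm{SG}^{m_e,m_\psi-k}_{\mathrm{cl}(x)}$ for all $k$. For such $a$, $\iota_{\mathrm{SG}}^{m_e,m_\psi}(a)$ denotes the continuous extension to $\mathbb{B}^d\times\mathbb{B}^s$ of $(1-h(y))^{m_e}(1-h(\gamma))^{m_\psi}a(\iota^{-1}(y),\iota^{-1}(\gamma))$, and $a$ is elliptic at a boundary point $(y_0,\gamma_0)$ if $\iota_{\mathrm{SG}}^{m_e,m_\psi}(a)(y_0,\gamma_0)\neq0$.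 Let $\varphi\in\mathrm{SG}^{1,1}_{\mathrm{cl}}(\mathbb{R}^d\times\mathbb{R}^s)$ be a classical $\mathrm{SG}$-phase function, that is, $\varphi$ is real-valued and there are $R,c>0$ with $\langle x\rangle^2|\nabla_x\varphi|^2+\langle\theta\rangle^2|\nabla_\theta\varphi|^2\ge c\langle x\rangle^2\langle\theta\rangle^2$ whenever $|x|+|\theta|\ge R$. Put $\lambda_\varphi(x,\theta)=(x,\nabla_x\varphi(x,\theta))$ and $\tilde\lambda_\varphi=(\iota\times\iota)\circ\lambda_\varphi\circ(\iota^{-1}\times\iota^{-1})$ on $(\mathbb{B}^d)^o\times(\mathbb{B}^s)^o$. Let $\widetilde{\mathcal{B}}_{\mathrm{ell}}$ be the set of those points of $\bigl((\mathbb{B}^d)^o\times\mathbb{S}^{s-1}\bigr)\cup\bigl(\mathbb{S}^{d-1}\times\mathbb{S}^{s-1}\bigr)$ at which $|\nabla_x\varphi|^2$, as a symbol of order $(0,2)$, is elliptic, and $$\widetilde{\mathcal{E}}=\bigl((\mathbb{B}^d)^o\times(\mathbb{B}^s)^o\bigr)\cup\bigl(\mathbb{S}^{d-1}\times(\mathbb{B}^s)^o\bigr)\cup\widetilde{\mathcal{B}}_{\mathrm{ell}}.$$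 Then $\tilde\lambda_\varphi$ extends to a map $\widetilde{\mathcal{E}}\to\mathbb{B}^d\times\mathbb{B}^d$ that is smooth (up to the boundary) on $\widetilde{\mathcal{E}}\subset\mathbb{B}^d\times\mathbb{B}^s$. -/

import Mathlib

open scoped ContDiff

noncomputable section

namespace SGPhase

/-- The Euclidean space `ℝⁿ`. -/
abbrev Eu (n : ℕ) : Type := EuclideanSpace ℝ (Fin n)

/-- The Japanese bracket `⟨z⟩ = √(1 + |z|²)`. -/
def jap {n : ℕ} (z : Eu n) : ℝ := Real.sqrt (1 + ‖z‖ ^ 2)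

section Symbols

variable {d s : ℕ} {W : Type*} [NormedAddCommGroup W] [NormedSpace ℝ W]

/-- `a ∈ SG^{me, mψ}(ℝᵈ × ℝˢ)`: `a` is smooth and all mixed derivatives satisfy
`|D_θ^k D_x^j a(x, θ)| ≤ C_{jk} ⟨x⟩^{me - j} ⟨θ⟩^{mψ - k}`. -/
def IsSGSymbol (me mψ : ℝ) (a : Eu d → Eu s → W) : Prop :=
  ContDiff ℝ ∞ (fun p : Eu d × Eu s => a p.1 p.2) ∧
    ∀ j k : ℕ, ∃ C : ℝ, ∀ (x : Eu d) (θ : Eu s),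
      ‖iteratedFDeriv ℝ k (fun θ' => iteratedFDeriv ℝ j (fun x' => a x' θ') x) θ‖
        ≤ C * jap x ^ (me - j) * jap θ ^ (mψ - k)

/-- A `0`-excision function: smooth, identically zero near the origin and identically one outside
a bounded set. -/
def IsExcision {n : ℕ} (χ : Eu n → ℝ) : Prop :=
  ContDiff ℝ ∞ χ ∧ (∃ ε : ℝ, 0 < ε ∧ ∀ x, ‖x‖ ≤ ε → χ x = 0) ∧ ∃ R : ℝ, ∀ x, R ≤ ‖x‖ → χ x = 1

/-- `a ∈ ℋ_x^m`: smooth on `(ℝᵈ ∖ 0) × ℝˢ` and homogeneous of degree `m` in `x`. -/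
def IsHomogX (m : ℝ) (a : Eu d → Eu s → W) : Prop :=
  ContDiffOn ℝ ∞ (fun p : Eu d × Eu s => a p.1 p.2) ({0}ᶜ ×ˢ Set.univ) ∧
    ∀ (x : Eu d) (θ : Eu s) (t : ℝ), x ≠ 0 → 0 < t → a (t • x) θ = t ^ m • a x θ

/-- `a ∈ ℋ_θ^m`: smooth on `ℝᵈ × (ℝˢ ∖ 0)` and homogeneous of degree `m` in `θ`. -/
def IsHomogTheta (m : ℝ) (a : Eu d → Eu s → W) : Prop :=
  ContDiffOn ℝ ∞ (fun p : Eu d × Eu s => a p.1 p.2) (Set.univ ×ˢ {0}ᶜ) ∧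
    ∀ (x : Eu d) (θ : Eu s) (t : ℝ), θ ≠ 0 → 0 < t → a x (t • θ) = t ^ m • a x θ

/-- `a` has the asymptotic expansion `∑ⱼ χ(x) Aⱼ(x, θ)` in the exit direction:
`a - ∑_{j < N} χ(x) Aⱼ ∈ SG^{me - N, mψ}` for all `N` (`N = 0` says `a ∈ SG^{me, mψ}`). -/
def HasExpansionX (me mψ : ℝ) (a : Eu d → Eu s → W) (χ : Eu d → ℝ)
    (A : ℕ → Eu d → Eu s → W) : Prop :=
  ∀ N : ℕ, IsSGSymbol (me - N) mψ
    (fun x θ => a x θ - ∑ j ∈ Finset.range N, χ x • A j x θ)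

/-- `a` has the asymptotic expansion `∑ₖ χ(θ) Aₖ(x, θ)` in the covariable:
`a - ∑_{k < N} χ(θ) Aₖ ∈ SG^{me, mψ - N}` for all `N` (`N = 0` says `a ∈ SG^{me, mψ}`). -/
def HasExpansionTheta (me mψ : ℝ) (a : Eu d → Eu s → W) (χ : Eu s → ℝ)
    (A : ℕ → Eu d → Eu s → W) : Prop :=
  ∀ N : ℕ, IsSGSymbol me (mψ - N)
    (fun x θ => a x θ - ∑ k ∈ Finset.range N, χ θ • A k x θ)

/-- `a ∈ SG_{cl(x)}^{me, mψ}`: polyhomogeneous with respect to `x`. -/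
def IsSGClassicalX (me mψ : ℝ) (a : Eu d → Eu s → W) : Prop :=
  ∃ (χ : Eu d → ℝ) (A : ℕ → Eu d → Eu s → W), IsExcision χ ∧
    (∀ j : ℕ, IsHomogX (me - j) (A j)) ∧ HasExpansionX me mψ a χ A

/-- `a ∈ SG_{cl(θ)}^{me, mψ}`: polyhomogeneous with respect to `θ`. -/
def IsSGClassicalTheta (me mψ : ℝ) (a : Eu d → Eu s → W) : Prop :=
  ∃ (χ : Eu s → ℝ) (A : ℕ → Eu d → Eu s → W), IsExcision χ ∧
    (∀ k : ℕ, IsHomogTheta (mψ - k) (A k)) ∧ HasExpansionTheta me mψ a χ A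

/-- `a ∈ SG_{cl}^{me, mψ}(ℝᵈ × ℝˢ)`: the `SG`-classical symbols. -/
def IsSGClassical (me mψ : ℝ) (a : Eu d → Eu s → W) : Prop :=
  (∃ (χ : Eu d → ℝ) (A : ℕ → Eu d → Eu s → W), IsExcision χ ∧
    (∀ j : ℕ, IsHomogX (me - j) (A j) ∧
      IsSGClassicalTheta (me - j) mψ (fun x θ => χ x • A j x θ)) ∧
    HasExpansionX me mψ a χ A) ∧
  (∃ (χ : Eu s → ℝ) (A : ℕ → Eu d → Eu s → W), IsExcision χ ∧
    (∀ k : ℕ, IsHomogTheta (mψ - k) (A k) ∧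
      IsSGClassicalX me (mψ - k) (fun x θ => χ θ • A k x θ)) ∧
    HasExpansionTheta me mψ a χ A)

end Symbols

/-- The partial gradient `∇_x φ(x, θ)`. -/
def gradX {d s : ℕ} (φ : Eu d → Eu s → ℝ) (x : Eu d) (θ : Eu s) : Eu d :=
  gradient (fun x' => φ x' θ) x

/-- The partial gradient `∇_θ φ(x, θ)`. -/
def gradTheta {d s : ℕ} (φ : Eu d → Eu s → ℝ) (x : Eu d) (θ : Eu s) : Eu s :=
  gradient (fun θ' => φ x θ') θ

/-- An `SG`-classical phase function of order `(1, 1)`: a real-valued `φ ∈ SG_{cl}^{1,1}` such that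
`Φ = ⟨x⟩² |∇_x φ|² + ⟨θ⟩² |∇_θ φ|²` is `SG`-elliptic of order `(2, 2)`. -/
def IsClassicalPhase {d s : ℕ} (φ : Eu d → Eu s → ℝ) : Prop :=
  IsSGClassical 1 1 φ ∧
    ∃ R c : ℝ, 0 < R ∧ 0 < c ∧ ∀ (x : Eu d) (θ : Eu s), R ≤ ‖x‖ + ‖θ‖ →
      c * (jap x ^ 2 * jap θ ^ 2)
        ≤ jap x ^ 2 * ‖gradX φ x θ‖ ^ 2 + jap θ ^ 2 * ‖gradTheta φ x θ‖ ^ 2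

/-- The open unit ball `(𝔹ⁿ)ᵒ`. -/
abbrev oball (n : ℕ) : Set (Eu n) := Metric.ball 0 1

/-- The closed unit ball `𝔹ⁿ`. -/
abbrev cball (n : ℕ) : Set (Eu n) := Metric.closedBall 0 1

/-- The unit sphere `∂𝔹ⁿ`. -/
abbrev usphere (n : ℕ) : Set (Eu n) := Metric.sphere 0 1

/-- A diffeomorphism `ι` from `ℝⁿ` onto the open unit ball with
`ι(x) = (x / |x|) (1 - 1 / |x|)` for `|x| > 3`, together with its inverse `inv` (which is
meaningful on the open unit ball only). -/
structure RadialDiffeo (n : ℕ) where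
  toFun : Eu n → Eu n
  inv : Eu n → Eu n
  contDiff_toFun : ContDiff ℝ ∞ toFun
  contDiffOn_inv : ContDiffOn ℝ ∞ inv (oball n)
  toFun_mem : ∀ x, toFun x ∈ oball n
  inv_toFun : ∀ x, inv (toFun x) = x
  toFun_inv : ∀ y ∈ oball n, toFun (inv y) = y
  toFun_of_large : ∀ x, 3 < ‖x‖ → toFun x = (1 - 1 / ‖x‖) • ((1 / ‖x‖) • x)

/-- A smooth function `h : 𝔹ⁿ → ℝ₊` with `h(y) = |y|` for `2/3 < |y| ≤ 1` and `1 - h(y) ≠ 0` for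
`|y| < 2/3`, so that `1 - h` is a boundary defining function of `𝔹ⁿ`. -/
structure BoundaryFn (n : ℕ) where
  h : Eu n → ℝ
  contDiffOn_h : ContDiffOn ℝ ∞ h (cball n)
  h_nonneg : ∀ y ∈ cball n, 0 ≤ h y
  h_eq_norm : ∀ y ∈ cball n, 2 / 3 < ‖y‖ → h y = ‖y‖
  one_sub_h_ne_zero : ∀ y, ‖y‖ < 2 / 3 → 1 - h y ≠ 0

section Ball

variable {d s : ℕ}

/-- The function `(1 - h(y))^{me} (1 - h(γ))^{mψ} a(ι⁻¹ y, ι⁻¹ γ)` on the interior of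
`𝔹ᵈ × 𝔹ˢ`. -/
def weightedPullback (ιd : RadialDiffeo d) (ιs : RadialDiffeo s) (hd : BoundaryFn d)
    (hs : BoundaryFn s) (me mψ : ℝ) (a : Eu d → Eu s → ℝ) (p : Eu d × Eu s) : ℝ :=
  (1 - hd.h p.1) ^ me * (1 - hs.h p.2) ^ mψ * a (ιd.inv p.1) (ιs.inv p.2)

/-- `ι_SG^{me, mψ}(a)` on `𝔹ᵈ × 𝔹ˢ`: the extension by continuity of the weighted pullback from the
interior to the boundary. -/
def iotaSG (ιd : RadialDiffeo d) (ιs : RadialDiffeo s) (hd : BoundaryFn d)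
    (hs : BoundaryFn s) (me mψ : ℝ) (a : Eu d → Eu s → ℝ) : Eu d × Eu s → ℝ :=
  extendFrom (oball d ×ˢ oball s) (weightedPullback ιd ιs hd hs me mψ a)

/-- The symbol `a` of order `(me, mψ)` is elliptic at the point `p` of the boundary of
`𝔹ᵈ × 𝔹ˢ`. -/
def IsEllipticAt (ιd : RadialDiffeo d) (ιs : RadialDiffeo s) (hd : BoundaryFn d)
    (hs : BoundaryFn s) (me mψ : ℝ) (a : Eu d → Eu s → ℝ) (p : Eu d × Eu s) : Prop :=
  iotaSG ιd ιs hd hs me mψ a p ≠ 0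

/-- The open face `∂𝔹ᵈ × (𝔹ˢ)ᵒ`. -/
def faceE (d s : ℕ) : Set (Eu d × Eu s) := usphere d ×ˢ oball s

/-- The open face `(𝔹ᵈ)ᵒ × ∂𝔹ˢ`. -/
def facePsi (d s : ℕ) : Set (Eu d × Eu s) := oball d ×ˢ usphere s

/-- The corner `∂𝔹ᵈ × ∂𝔹ˢ`. -/
def facePsiE (d s : ℕ) : Set (Eu d × Eu s) := usphere d ×ˢ usphere s

/-- The points of the closed face `𝔹ᵈ × ∂𝔹ˢ` where `|∇_x φ|²`, a symbol of order `(0, 2)`, is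
elliptic. -/
def ellipticSet (ιd : RadialDiffeo d) (ιs : RadialDiffeo s) (hd : BoundaryFn d)
    (hs : BoundaryFn s) (φ : Eu d → Eu s → ℝ) : Set (Eu d × Eu s) :=
  {p | p ∈ facePsi d s ∪ facePsiE d s ∧
    IsEllipticAt ιd ιs hd hs 0 2 (fun x θ => ‖gradX φ x θ‖ ^ 2) p}

/-- The domain of the extension: the interior, the face `∂𝔹ᵈ × (𝔹ˢ)ᵒ` and the elliptic points of
`𝔹ᵈ × ∂𝔹ˢ`. -/
def extDomain (ιd : RadialDiffeo d) (ιs : RadialDiffeo s) (hd : BoundaryFn d)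
    (hs : BoundaryFn s) (φ : Eu d → Eu s → ℝ) : Set (Eu d × Eu s) :=
  (oball d ×ˢ oball s) ∪ faceE d s ∪ ellipticSet ιd ιs hd hs φ

/-- The map `λ_φ(x, θ) = (x, ∇_x φ(x, θ))`. -/
def lambdaMap (φ : Eu d → Eu s → ℝ) (p : Eu d × Eu s) : Eu d × Eu d :=
  (p.1, gradX φ p.1 p.2)

/-- The map `(ι × ι) ∘ λ_φ ∘ (ι⁻¹ × ι⁻¹)`, meaningful on the interior of `𝔹ᵈ × 𝔹ˢ`. -/
def lambdaTilde (ιd : RadialDiffeo d) (ιs : RadialDiffeo s) (φ : Eu d → Eu s → ℝ) :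
    Eu d × Eu s → Eu d × Eu d :=
  Prod.map ιd.toFun ιd.toFun ∘ lambdaMap φ ∘ Prod.map ιd.inv ιs.inv

end Ball

end SGPhase

end

/-!
The extension of `(ι × ι) ∘ λ_φ ∘ (ι⁻¹ × ι⁻¹)` is the extension by continuity from the interior. By
`BddDerivs.contDiffWithinAt_extendFrom` it is smooth up to the boundary at `p` as soon as every
derivative of the map is bounded near `p`: on a convex set such a function has Lipschitz derivatives,
which therefore extend to the closure. All boundary behaviour is thus expressed through the predicate
`BddDerivs l f` (boundedness of all derivatives along a filter), which is stable under products,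
differentiation and composition with smooth maps.

The analytic core is that the weighted pullback `(1 - |y|)^m (1 - |γ|)^r a(ι⁻¹ y, ι⁻¹ γ)` of a
classical symbol `a` has bounded derivatives near the boundary. Near a sphere, `ι⁻¹` and the weights
are *tame*: each derivative is bounded by a power of `1 / (1 - |γ|)`, the power depending only on the
order of the derivative (`Tame`). Remainders of high order in the expansion of `a` beat any such
power, while by homogeneity the terms of the expansion become `(1 - |γ|)^k` times a coefficient
evaluated on the unit sphere (`PolyhomExpansion.bddDerivs`). At the corner, a neighbourhood is split
according to which of `1 - |y|` and `1 - |γ|` is smaller; in each part the expansion in the variable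
closer to its sphere suffices, since the weights of the other variable are dominated
(`IsSGClassical.bddDerivs_corner`). The symbol estimates enter only through total derivatives
(`IsSGSymbol.symbolBounds`), which makes the two variables interchangeable.

Bounds for the pullback of `∇ₓφ` follow from those for `φ` by the chain rule, because `|x| Dι(x)`, as
a function of `y = ι(x)`, is smooth up to the sphere (`RadialDiffeo.norm_smul_fderiv`). On the face
`|y| = 1, |γ| < 1` this bounds the derivatives of `∇ₓφ` itself. At a point with `|γ| = 1` it bounds
those of `W = (1 - |γ|) ∇ₓφ`; ellipticity of `|∇ₓφ|²` says that `W` has a nonzero limit, and there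
`ι(∇ₓφ) = (1 - (1 - |γ|) / |W|) W / |W|` is a smooth function of `W` and `γ`.
-/

open Filter Topology Asymptotics

namespace SGPhase

/-! ### Functions with tame derivatives along a filter -/

theorem exists_bound_of_forall_isBigO {E : Type*} {V : ℕ → Type*} [∀ i, NormedAddCommGroup (V i)]
    {l : Filter E} {n : ℕ} {f : ∀ i, E → V i} {u : E → ℝ}
    (h : ∀ i ≤ n, f i =O[l] u) :
    ∃ C : ℝ, 1 ≤ C ∧ ∀ᶠ q in l, ∀ i ≤ n, ‖f i q‖ ≤ C * |u q| := by
  choose! C hC using fun i hi => (h i hi).bound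
  refine ⟨1 + ∑ i ∈ Finset.range (n + 1), |C i|, ?_, ?_⟩
  · have : 0 ≤ ∑ i ∈ Finset.range (n + 1), |C i| := Finset.sum_nonneg fun _ _ => abs_nonneg _
    linarith
  · have : ∀ᶠ q in l, ∀ i ∈ Finset.range (n + 1), ‖f i q‖ ≤ C i * ‖u q‖ :=
      (eventually_all_finset _).2 fun i hi => hC i (Nat.lt_succ_iff.1 (Finset.mem_range.1 hi))
    filter_upwards [this] with q hq i hi
    have hi' : i ∈ Finset.range (n + 1) := Finset.mem_range.2 (Nat.lt_succ_iff.2 hi)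
    refine (hq i hi').trans ?_
    rw [Real.norm_eq_abs]
    gcongr
    calc C i ≤ |C i| := le_abs_self _
      _ ≤ ∑ i ∈ Finset.range (n + 1), |C i| :=
        Finset.single_le_sum (f := fun i => |C i|) (fun _ _ => abs_nonneg _) hi'
      _ ≤ _ := by linarith

theorem isBigO_pow_of_le {E : Type*} {l : Filter E} {w : E → ℝ} (hw : ∀ᶠ q in l, 1 ≤ w q) {K K' : ℕ}
    (h : K ≤ K') : (fun q => w q ^ K) =O[l] fun q => w q ^ K' := by
  refine IsBigO.of_bound 1 ?_
  filter_upwards [hw] with q hq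
  rw [Real.norm_of_nonneg (by positivity), Real.norm_of_nonneg (by positivity), one_mul]
  exact pow_le_pow_right₀ hq h

section TameCalculus

variable {E F G H : Type*} [NormedAddCommGroup E] [NormedSpace ℝ E] [NormedAddCommGroup F]
  [NormedSpace ℝ F] [NormedAddCommGroup G] [NormedSpace ℝ G] [NormedAddCommGroup H]
  [NormedSpace ℝ H]

/-- `f` is smooth along the filter `l` and each of its derivatives is bounded along `l` by some
power of the weight `w`; the power may depend on the order of the derivative. -/
def Tame (w : E → ℝ) (l : Filter E) (f : E → F) : Prop :=
  (∀ᶠ q in l, ContDiffAt ℝ ∞ f q) ∧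
    ∀ n : ℕ, ∃ K : ℕ, iteratedFDeriv ℝ n f =O[l] fun q => w q ^ K

/-- `f` is smooth along the filter `l` and each of its derivatives is bounded along `l`. -/
def BddDerivs (l : Filter E) (f : E → F) : Prop :=
  (∀ᶠ q in l, ContDiffAt ℝ ∞ f q) ∧
    ∀ n : ℕ, iteratedFDeriv ℝ n f =O[l] fun _ => (1 : ℝ)

theorem exists_open_contDiffOn {f : E → F} {x : E} {n : ℕ} (hf : ContDiffAt ℝ ∞ f x) :
    ∃ s : Set E, IsOpen s ∧ x ∈ s ∧ ContDiffOn ℝ n f s := by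
  have h : ContDiffAt ℝ n f x := hf.of_le (by exact_mod_cast le_top)
  obtain ⟨u, hu, hfu⟩ := h.contDiffOn le_rfl (by simp)
  obtain ⟨s, hsu, hs, hxs⟩ := mem_nhds_iff.1 (by simpa using hu)
  exact ⟨s, hs, hxs, hfu.mono hsu⟩

theorem norm_iteratedFDeriv_bilinear_le (B : F →L[ℝ] G →L[ℝ] H) {f : E → F} {g : E → G} {x : E}
    (hf : ContDiffAt ℝ ∞ f x) (hg : ContDiffAt ℝ ∞ g x) (n : ℕ) :
    ‖iteratedFDeriv ℝ n (fun y => B (f y) (g y)) x‖ ≤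
      ‖B‖ * ∑ i ∈ Finset.range (n + 1),
        (n.choose i : ℝ) * ‖iteratedFDeriv ℝ i f x‖ * ‖iteratedFDeriv ℝ (n - i) g x‖ := by
  obtain ⟨s, hs, hxs, hfs⟩ := exists_open_contDiffOn (n := n) hf
  obtain ⟨t, ht, hxt, hgt⟩ := exists_open_contDiffOn (n := n) hg
  have ho := hs.inter ht
  have key := B.norm_iteratedFDerivWithin_le_of_bilinear (hfs.mono Set.inter_subset_left)
    (hgt.mono Set.inter_subset_right) ho.uniqueDiffOn (x := x) ⟨hxs, hxt⟩ (n := n) le_rfl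
  simpa only [iteratedFDerivWithin_of_isOpen _ ho (⟨hxs, hxt⟩ : x ∈ s ∩ t)] using key

theorem norm_iteratedFDeriv_comp_le_of_contDiffAt {f : E → F} {g : F → G} {x : E}
    (hf : ContDiffAt ℝ ∞ f x) (hg : ContDiffAt ℝ ∞ g (f x)) {n : ℕ} {C D : ℝ}
    (hC : ∀ i ≤ n, ‖iteratedFDeriv ℝ i g (f x)‖ ≤ C)
    (hD : ∀ i, 1 ≤ i → i ≤ n → ‖iteratedFDeriv ℝ i f x‖ ≤ D ^ i) :
    ‖iteratedFDeriv ℝ n (g ∘ f) x‖ ≤ n.factorial * C * D ^ n := by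
  obtain ⟨s, hs, hxs, hfs⟩ := exists_open_contDiffOn (n := n) hf
  obtain ⟨t, ht, hxt, hgt⟩ := exists_open_contDiffOn (n := n) hg
  have ho : IsOpen (s ∩ f ⁻¹' t) := hfs.continuousOn.isOpen_inter_preimage hs ht
  have hx : x ∈ s ∩ f ⁻¹' t := ⟨hxs, hxt⟩
  have key := norm_iteratedFDerivWithin_comp_le hgt (hfs.mono Set.inter_subset_left) le_rfl
    ht.uniqueDiffOn ho.uniqueDiffOn (x := x) (fun y hy => hy.2) hx (n := n) (C := C) (D := D)
  simp only [iteratedFDerivWithin_of_isOpen _ ho hx, iteratedFDerivWithin_of_isOpen _ ht hxt] at key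
  exact key hC hD

theorem isBigO_iteratedFDeriv_bilinear (B : F →L[ℝ] G →L[ℝ] H) {l : Filter E} {f : E → F}
    {g : E → G} (hf : ∀ᶠ q in l, ContDiffAt ℝ ∞ f q) (hg : ∀ᶠ q in l, ContDiffAt ℝ ∞ g q)
    {u v : E → ℝ} {n : ℕ} (hu : ∀ i ≤ n, iteratedFDeriv ℝ i f =O[l] u)
    (hv : ∀ i ≤ n, iteratedFDeriv ℝ i g =O[l] v) :
    iteratedFDeriv ℝ n (fun y => B (f y) (g y)) =O[l] fun q => u q * v q := by
  obtain ⟨C, hC1, hC⟩ := exists_bound_of_forall_isBigO hu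
  obtain ⟨D, hD1, hD⟩ := exists_bound_of_forall_isBigO hv
  refine IsBigO.of_bound (‖B‖ * ∑ i ∈ Finset.range (n + 1), (n.choose i : ℝ) * C * D) ?_
  filter_upwards [hf, hg, hC, hD] with q hfq hgq hCq hDq
  refine (norm_iteratedFDeriv_bilinear_le B hfq hgq n).trans ?_
  rw [mul_assoc, Finset.sum_mul, Real.norm_eq_abs, abs_mul]
  refine mul_le_mul_of_nonneg_left (Finset.sum_le_sum fun i hi => ?_) (by positivity)
  have hi' := Nat.lt_succ_iff.1 (Finset.mem_range.1 hi)
  calc (n.choose i : ℝ) * ‖iteratedFDeriv ℝ i f q‖ * ‖iteratedFDeriv ℝ (n - i) g q‖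
      ≤ (n.choose i : ℝ) * (C * |u q|) * (D * |v q|) := by
        gcongr
        · exact hCq i hi'
        · exact hDq _ (Nat.sub_le _ _)
    _ = _ := by ring

theorem isBigO_iteratedFDeriv_comp {l : Filter E} {f : E → F} {g : F → G}
    (hf : ∀ᶠ q in l, ContDiffAt ℝ ∞ f q) (hg : ∀ᶠ q in l, ContDiffAt ℝ ∞ g (f q))
    {u v : E → ℝ} (h1u : ∀ᶠ q in l, 1 ≤ u q) {n : ℕ}
    (hu : ∀ i ≤ n, iteratedFDeriv ℝ i f =O[l] u)
    (hv : ∀ i ≤ n, (fun q => iteratedFDeriv ℝ i g (f q)) =O[l] v) :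
    iteratedFDeriv ℝ n (g ∘ f) =O[l] fun q => v q * u q ^ n := by
  obtain ⟨C, hC1, hC⟩ := exists_bound_of_forall_isBigO hu
  obtain ⟨D, hD1, hD⟩ := exists_bound_of_forall_isBigO hv
  refine IsBigO.of_bound (n.factorial * D * C ^ n) ?_
  filter_upwards [hf, hg, hC, hD, h1u] with q hfq hgq hCq hDq huq
  have hCu : 1 ≤ C * u q := one_le_mul_of_one_le_of_one_le hC1 huq
  refine (norm_iteratedFDeriv_comp_le_of_contDiffAt hfq hgq hDq (D := C * u q) ?_).trans ?_
  · intro i hi hin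
    have := hCq i hin
    rw [abs_of_nonneg (by linarith)] at this
    exact this.trans (le_self_pow₀ hCu (by omega))
  · rw [Real.norm_eq_abs, abs_mul, abs_of_nonneg (a := u q ^ n) (by positivity), mul_pow]
    apply le_of_eq
    ring

theorem BddDerivs.tame {l : Filter E} {f : E → F} (hf : BddDerivs l f) (w : E → ℝ) :
    Tame w l f := ⟨hf.1, fun n => ⟨0, by simpa using hf.2 n⟩⟩

theorem BddDerivs.mono {l l' : Filter E} {f : E → F} (hf : BddDerivs l f) (h : l' ≤ l) :
    BddDerivs l' f :=
  ⟨h hf.1, fun n => (hf.2 n).mono h⟩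

theorem Tame.exists_uniform {l : Filter E} {w : E → ℝ} {f : E → F} (hf : Tame w l f)
    (hw : ∀ᶠ q in l, 1 ≤ w q) (n : ℕ) :
    ∃ K : ℕ, ∀ i ≤ n, iteratedFDeriv ℝ i f =O[l] fun q => w q ^ K := by
  choose K hK using hf.2
  refine ⟨∑ i ∈ Finset.range (n + 1), K i, fun i hi => (hK i).trans (isBigO_pow_of_le hw ?_)⟩
  exact Finset.single_le_sum (f := K) (fun _ _ => Nat.zero_le _)
    (Finset.mem_range.2 (Nat.lt_succ_iff.2 hi))

theorem iteratedFDeriv_eventuallyEq {l : Filter E} {f g : E → F}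
    (h : ∀ᶠ q in l, f =ᶠ[𝓝 q] g) (n : ℕ) :
    iteratedFDeriv ℝ n f =ᶠ[l] iteratedFDeriv ℝ n g := by
  filter_upwards [h] with q hq
  exact (hq.iteratedFDeriv (𝕜 := ℝ) n).eq_of_nhds

theorem Tame.congr {l : Filter E} {w : E → ℝ} {f g : E → F} (hf : Tame w l f)
    (h : ∀ᶠ q in l, f =ᶠ[𝓝 q] g) : Tame w l g := by
  refine ⟨?_, fun n => (hf.2 n).imp fun K hK =>
    hK.congr' (iteratedFDeriv_eventuallyEq h n) EventuallyEq.rfl⟩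
  filter_upwards [hf.1, h] with q h1 h2
  exact h1.congr_of_eventuallyEq h2.symm

theorem BddDerivs.congr {l : Filter E} {f g : E → F} (hf : BddDerivs l f)
    (h : ∀ᶠ q in l, f =ᶠ[𝓝 q] g) : BddDerivs l g := by
  refine ⟨?_, fun n => (hf.2 n).congr' (iteratedFDeriv_eventuallyEq h n) EventuallyEq.rfl⟩
  filter_upwards [hf.1, h] with q h1 h2
  exact h1.congr_of_eventuallyEq h2.symm

theorem BddDerivs.sup {l l' : Filter E} {f : E → F} (hf : BddDerivs l f) (hf' : BddDerivs l' f) :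
    BddDerivs (l ⊔ l') f :=
  ⟨eventually_sup.2 ⟨hf.1, hf'.1⟩, fun n => (hf.2 n).sup (hf'.2 n)⟩

theorem BddDerivs.of_contDiffAt {l : Filter E} {f : E → F} {p : E} (hl : l ≤ 𝓝 p)
    (hf : ∀ᶠ q in 𝓝 p, ContDiffAt ℝ ∞ f q) : BddDerivs l f := by
  refine ⟨hl hf, fun n => ?_⟩
  have h := hf.self_of_nhds.iteratedFDeriv_right (m := 0) (i := n) (by simp; exact_mod_cast le_top)
  exact (h.continuousAt.isBigO_one ℝ).mono hl

theorem BddDerivs.bilinear (B : F →L[ℝ] G →L[ℝ] H) {l : Filter E} {f : E → F} {g : E → G}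
    (hf : BddDerivs l f) (hg : BddDerivs l g) : BddDerivs l (fun y => B (f y) (g y)) := by
  refine ⟨?_, fun n => by
    simpa using isBigO_iteratedFDeriv_bilinear B hf.1 hg.1 (fun i _ => hf.2 i) fun i _ => hg.2 i⟩
  filter_upwards [hf.1, hg.1] with q h1 h2
  exact (B.contDiff.contDiffAt.comp q h1).clm_apply h2

theorem BddDerivs.smul {l : Filter E} {f : E → ℝ} {g : E → G}
    (hf : BddDerivs l f) (hg : BddDerivs l g) : BddDerivs l (fun y => f y • g y) :=
  hf.bilinear (ContinuousLinearMap.lsmul ℝ ℝ) hg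

theorem Tame.bilinear (B : F →L[ℝ] G →L[ℝ] H) {l : Filter E} {w : E → ℝ} {f : E → F} {g : E → G}
    (hw : ∀ᶠ q in l, 1 ≤ w q)
    (hf : Tame w l f) (hg : Tame w l g) : Tame w l (fun y => B (f y) (g y)) := by
  refine ⟨?_, fun n => ?_⟩
  · filter_upwards [hf.1, hg.1] with q h1 h2
    exact (B.contDiff.contDiffAt.comp q h1).clm_apply h2
  · obtain ⟨K, hK⟩ := hf.exists_uniform hw n
    obtain ⟨K', hK'⟩ := hg.exists_uniform hw n
    exact ⟨K + K', by simpa [pow_add] using isBigO_iteratedFDeriv_bilinear B hf.1 hg.1 hK hK'⟩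

theorem Tame.smul {l : Filter E} {w : E → ℝ} {f : E → ℝ} {g : E → G} (hw : ∀ᶠ q in l, 1 ≤ w q)
    (hf : Tame w l f) (hg : Tame w l g) : Tame w l (fun y => f y • g y) :=
  hf.bilinear (ContinuousLinearMap.lsmul ℝ ℝ) hw hg

theorem BddDerivs.comp {l : Filter E} {f : E → F} {g : F → G} {c : F} (hf : BddDerivs l f)
    (hc : Tendsto f l (𝓝 c)) (hg : ∀ᶠ z in 𝓝 c, ContDiffAt ℝ ∞ g z) :
    BddDerivs l (g ∘ f) := by
  have hg' := BddDerivs.of_contDiffAt le_rfl hg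
  refine ⟨?_, fun n => ?_⟩
  · filter_upwards [hf.1, hc.eventually hg] with q h1 h2
    exact h2.comp q h1
  · simpa using isBigO_iteratedFDeriv_comp hf.1 (hc.eventually hg) (u := fun _ => 1)
      (v := fun _ => 1) (by simp) (fun i _ => hf.2 i) fun i _ => (hg'.2 i).comp_tendsto hc

theorem Tame.prodMk {l : Filter E} {w : E → ℝ} {f : E → F} {g : E → G}
    (hw : ∀ᶠ q in l, 1 ≤ w q) (hf : Tame w l f)
    (hg : Tame w l g) : Tame w l (fun y => (f y, g y)) := by
  refine ⟨?_, fun n => ?_⟩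
  · filter_upwards [hf.1, hg.1] with q h1 h2
    exact h1.prodMk h2
  · obtain ⟨K, hK⟩ := hf.2 n
    obtain ⟨K', hK'⟩ := hg.2 n
    refine ⟨K + K', ?_⟩
    have h1 := hK.trans (isBigO_pow_of_le hw (Nat.le_add_right K K'))
    have h2 := hK'.trans (isBigO_pow_of_le hw (Nat.le_add_left K' K))
    refine IsBigO.of_norm_left ((h1.prod_left h2).norm_left.congr' ?_ EventuallyEq.rfl)
    filter_upwards [hf.1, hg.1] with q h3 h4
    rw [iteratedFDeriv_prodMk h3 h4 (by exact_mod_cast le_top),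
      ContinuousMultilinearMap.opNorm_prod, Prod.norm_mk]

theorem BddDerivs.prodMk {l : Filter E} {f : E → F} {g : E → G} (hf : BddDerivs l f)
    (hg : BddDerivs l g) : BddDerivs l (fun y => (f y, g y)) := by
  obtain ⟨h1, h2⟩ := (hf.tame fun _ => 1).prodMk (by simp) (hg.tame fun _ => 1)
  exact ⟨h1, fun n => by simpa using h2 n⟩

theorem BddDerivs.add {l : Filter E} {f g : E → F} (hf : BddDerivs l f)
    (hg : BddDerivs l g) : BddDerivs l (fun y => f y + g y) := by
  refine ⟨?_, fun n => ((hf.2 n).add (hg.2 n)).congr' ?_ EventuallyEq.rfl⟩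
  · filter_upwards [hf.1, hg.1] with q h1 h2
    exact h1.add h2
  · filter_upwards [hf.1, hg.1] with q h1 h2
    exact (iteratedFDeriv_add_apply (h1.of_le (by exact_mod_cast le_top))
      (h2.of_le (by exact_mod_cast le_top))).symm

theorem BddDerivs.const (l : Filter E) (c : F) : BddDerivs l fun _ => c := by
  refine ⟨Eventually.of_forall fun _ => contDiffAt_const, fun n => ?_⟩
  rcases Nat.eq_zero_or_pos n with rfl | hn
  · refine IsBigO.of_bound ‖c‖ (Eventually.of_forall fun q => by simp)
  · rw [iteratedFDeriv_const_of_ne (by omega)]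
    exact isBigO_zero _ _

theorem BddDerivs.sum {ι : Type*} {l : Filter E} (s : Finset ι) {f : ι → E → F}
    (hf : ∀ i ∈ s, BddDerivs l (f i)) : BddDerivs l (fun y => ∑ i ∈ s, f i y) := by
  classical
  induction s using Finset.induction_on with
  | empty => simpa using BddDerivs.const l (0 : F)
  | insert a s ha ih =>
    simp only [Finset.sum_insert ha]
    exact (hf a (Finset.mem_insert_self a s)).add
      (ih fun i hi => hf i (Finset.mem_insert_of_mem hi))

theorem BddDerivs.fderiv {l : Filter E} {f : E → F} (hf : BddDerivs l f) :
    BddDerivs l (fderiv ℝ f) := by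
  refine ⟨hf.1.mono fun q hq => hq.fderiv_right (by simp), fun n => ?_⟩
  refine IsBigO.of_norm_left (((hf.2 (n + 1)).norm_left).congr_left fun q => ?_)
  rw [norm_iteratedFDeriv_fderiv]

theorem BddDerivs.clm_comp (L : F →L[ℝ] G) {l : Filter E} {f : E → F} (hf : BddDerivs l f) :
    BddDerivs l (fun y => L (f y)) := by
  refine ⟨hf.1.mono fun q hq => L.contDiff.contDiffAt.comp q hq, fun n => ?_⟩
  refine (IsBigO.of_bound ‖L‖ ?_).trans (hf.2 n)
  filter_upwards [hf.1] with q hq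
  exact L.norm_iteratedFDeriv_comp_left (f := f) hq (by exact_mod_cast le_top)

/-- Real powers of a small positive tame function are tame as soon as the weight controls its
inverse. The induction on the order of the derivative is over all exponents at once, because
`D (ρ ^ m) = m ρ ^ (m - 1) Dρ`. -/
theorem Tame.rpow {l : Filter E} {w ρ : E → ℝ} (hρ : Tame w l ρ) (hw : ∀ᶠ q in l, 1 ≤ w q)
    (hpos : ∀ᶠ q in l, 0 < ρ q) (hle : ∀ᶠ q in l, ρ q ≤ 1)
    (hinv : ∀ᶠ q in l, (ρ q)⁻¹ ≤ w q) (m : ℝ) :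
    Tame w l (fun q => ρ q ^ m) := by
  have hsm : ∀ m : ℝ, ∀ᶠ q in l, ContDiffAt ℝ ∞ (fun q => ρ q ^ m) q := fun m => by
    filter_upwards [hρ.1, hpos] with q h1 h2
    exact h1.rpow_const_of_ne h2.ne'
  refine ⟨hsm m, fun n => ?_⟩
  suffices h : ∀ n : ℕ, ∀ m : ℝ, ∃ K : ℕ, ∀ i ≤ n,
      iteratedFDeriv ℝ i (fun q => ρ q ^ m) =O[l] fun q => w q ^ K by
    obtain ⟨K, hK⟩ := h n m
    exact ⟨K, hK n le_rfl⟩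
  clear n m
  intro n
  induction n with
  | zero =>
    intro m
    refine ⟨⌈|m|⌉₊, fun i hi => ?_⟩
    obtain rfl : i = 0 := by omega
    refine IsBigO.of_bound 1 ?_
    filter_upwards [hw, hpos, hle, hinv] with q h1 h2 h3 h4
    rw [norm_iteratedFDeriv_zero, Real.norm_of_nonneg (by positivity),
      Real.norm_of_nonneg (by positivity), one_mul]
    calc ρ q ^ m ≤ ρ q ^ (-|m|) := Real.rpow_le_rpow_of_exponent_ge h2 h3 (neg_abs_le m)
      _ = (ρ q)⁻¹ ^ |m| := by rw [Real.rpow_neg h2.le, Real.inv_rpow h2.le]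
      _ ≤ w q ^ |m| := by gcongr
      _ ≤ w q ^ (⌈|m|⌉₊ : ℝ) := Real.rpow_le_rpow_of_exponent_le h1 (Nat.le_ceil _)
      _ = w q ^ ⌈|m|⌉₊ := Real.rpow_natCast _ _
  | succ n ih =>
    intro m
    obtain ⟨K, hK⟩ := ih (m - 1)
    obtain ⟨K₀, hK₀⟩ := ih m
    obtain ⟨K', hK'⟩ := hρ.exists_uniform hw (n + 1)
    have hder : ∀ᶠ q in l, fderiv ℝ (fun q => ρ q ^ m) =ᶠ[𝓝 q]
        fun q => ContinuousLinearMap.lsmul ℝ ℝ (ρ q ^ (m - 1)) (m • fderiv ℝ ρ q) := by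
      filter_upwards [hρ.1, hpos] with q h1 h2
      have h1' : ∀ᶠ q' in 𝓝 q, DifferentiableAt ℝ ρ q' :=
        (h1.of_le (m := 1) (by simp)).eventually (by simp) |>.mono
          fun q' hq' => hq'.differentiableAt (by simp)
      filter_upwards [h1', h1.continuousAt.eventually (lt_mem_nhds h2)] with q' h3 h4
      rw [(h3.hasFDerivAt.rpow_const (Or.inl h4.ne')).fderiv]
      simp [smul_smul]
    refine ⟨K₀ + (K + K'), fun i hi => ?_⟩
    rcases hi.lt_or_eq with hi | rfl
    · exact (hK₀ i (by omega)).trans (isBigO_pow_of_le hw (by omega))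
    · have hD : ∀ i ≤ n, iteratedFDeriv ℝ i (fun q => m • fderiv ℝ ρ q)
          =O[l] fun q => w q ^ K' := fun i hi => by
        refine (IsBigO.of_bound |m| ?_).trans (hK' (i + 1) (by omega))
        filter_upwards [hρ.1] with q hq
        rw [iteratedFDeriv_const_smul_apply' ((hq.fderiv_right (m := ∞) (by simp)).of_le
          (by exact_mod_cast le_top)), norm_smul, norm_iteratedFDeriv_fderiv, Real.norm_eq_abs]
      have key := isBigO_iteratedFDeriv_bilinear (ContinuousLinearMap.lsmul ℝ ℝ)
        (hsm (m - 1)) (g := fun q => m • fderiv ℝ ρ q)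
        (hρ.1.mono fun q hq => (hq.fderiv_right (m := ∞) (by simp)).const_smul m)
        hK hD
      have key' : iteratedFDeriv ℝ n (fderiv ℝ (fun q => ρ q ^ m)) =O[l]
          fun q => w q ^ (K₀ + (K + K')) := by
        refine (key.congr' (iteratedFDeriv_eventuallyEq hder n).symm EventuallyEq.rfl).trans ?_
        simp only [← pow_add]
        exact isBigO_pow_of_le hw (by omega)
      exact IsBigO.of_norm_left (key'.norm_left.congr_left fun q => norm_iteratedFDeriv_fderiv)

end TameCalculus

/-! ### Smooth extension to the closure of a convex open set -/

theorem exists_tendsto_of_lipschitzOnWith {E F : Type*} [PseudoMetricSpace E]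
    [PseudoMetricSpace F] [CompleteSpace F] {f : E → F} {V : Set E} {C : NNReal}
    (hf : LipschitzOnWith C f V) {q : E} (hq : q ∈ closure V) :
    ∃ y, Tendsto f (𝓝[V] q) (𝓝 y) := by
  have : (𝓝[V] q).NeBot := mem_closure_iff_nhdsWithin_neBot.1 hq
  refine cauchy_map_iff_exists_tendsto.1 (Metric.cauchy_iff.2 ⟨inferInstance, fun ε hε => ?_⟩)
  have hδ : 0 < ε / (2 * (C + 1)) := by positivity
  refine ⟨f '' (Metric.ball q (ε / (2 * (C + 1))) ∩ V), image_mem_map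
    (inter_mem (mem_nhdsWithin_of_mem_nhds (Metric.ball_mem_nhds q hδ)) self_mem_nhdsWithin), ?_⟩
  rintro _ ⟨x, ⟨hx, hxV⟩, rfl⟩ _ ⟨y, ⟨hy, hyV⟩, rfl⟩
  have h1 := hf.dist_le_mul x hxV y hyV
  have h2 := dist_triangle_right x y q
  rw [Metric.mem_ball] at hx hy
  have h3 : dist x y < ε / (C + 1) := by
    have : ε / (C + 1) = ε / (2 * (C + 1)) + ε / (2 * (C + 1)) := by field_simp; ring
    linarith
  calc dist (f x) (f y) ≤ C * dist x y := h1
    _ ≤ (C + 1) * dist x y := by gcongr; linarith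
    _ < (C + 1) * (ε / (C + 1)) := by gcongr
    _ = ε := by field_simp

section Extension

variable {E F : Type*} [NormedAddCommGroup E] [NormedSpace ℝ E] [NormedAddCommGroup F]
  [NormedSpace ℝ F] [CompleteSpace F]

/-- A function on a convex open set with bounded derivatives up to order `n + 1` is, after passing
to limits at the boundary points, of class `C^n` on the closure: the mean value inequality makes
each derivative of order at most `n` Lipschitz, so that all of them extend continuously, and the
extensions form a Taylor series. -/
theorem contDiffOn_extendFrom_of_bound {V : Set E} (hV : IsOpen V) (hc : Convex ℝ V) {f : E → F}
    (hf : ∀ q ∈ V, ContDiffAt ℝ ∞ f q) {n : ℕ} {C : ℝ}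
    (hC : ∀ q ∈ V, ∀ i ≤ n + 1, ‖iteratedFDeriv ℝ i f q‖ ≤ C) :
    (∀ q ∈ closure V, ∃ y, Tendsto f (𝓝[V] q) (𝓝 y)) ∧
      ContDiffOn ℝ n (extendFrom V f) (closure V) := by
  have hdiff : ∀ i, ∀ q ∈ V, DifferentiableAt ℝ (iteratedFDeriv ℝ i f) q := fun i q hq =>
    (hf q hq).differentiableAt_iteratedFDeriv (by exact_mod_cast ENat.natCast_lt_top i)
  have hlim : ∀ i ≤ n, ∀ q ∈ closure V, ∃ y, Tendsto (iteratedFDeriv ℝ i f) (𝓝[V] q) (𝓝 y) := by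
    intro i hi q hq
    refine exists_tendsto_of_lipschitzOnWith (C := C.toNNReal)
      (hc.lipschitzOnWith_of_nnnorm_fderiv_le (𝕜 := ℝ) (hdiff i) fun x hx => ?_) hq
    rw [← norm_toNNReal, norm_fderiv_iteratedFDeriv]
    exact Real.toNNReal_le_toNNReal (hC x hx _ (by omega))
  have h0 : ∀ q ∈ closure V, Tendsto f (𝓝[V] q)
      (𝓝 ((extendFrom V (iteratedFDeriv ℝ 0 f) q).curry0)) := fun q hq => by
    have h1 := tendsto_extendFrom (hlim 0 (Nat.zero_le _) q hq)
    exact ((continuousMultilinearCurryFin0 ℝ E F).continuous.tendsto _).comp h1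
  refine ⟨fun q hq => ⟨_, h0 q hq⟩, ?_⟩
  have hP : ∀ i ≤ n, ∀ q ∈ V, extendFrom V (iteratedFDeriv ℝ i f) q = iteratedFDeriv ℝ i f q :=
    fun i hi q hq => extendFrom_extends
      (fun x hx => (hdiff i x hx).continuousAt.continuousWithinAt) q hq
  have hcont : ∀ i ≤ n, ContinuousOn (extendFrom V (iteratedFDeriv ℝ i f)) (closure V) :=
    fun i hi => continuousOn_extendFrom subset_rfl (hlim i hi)
  have hT : HasFTaylorSeriesUpToOn n (extendFrom V f)
      (fun q i => extendFrom V (iteratedFDeriv ℝ i f) q) (closure V) := by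
    refine ⟨fun q hq => (extendFrom_eq hq (h0 q hq)).symm, fun m hm q hq => ?_,
      fun m hm => hcont m (by exact_mod_cast hm)⟩
    have hm' : m < n := by exact_mod_cast hm
    have heq : ∀ x ∈ V, extendFrom V (iteratedFDeriv ℝ m f) =ᶠ[𝓝 x] iteratedFDeriv ℝ m f :=
      fun x hx => by
        filter_upwards [hV.mem_nhds hx] with y hy using hP m hm'.le y hy
    refine hasFDerivWithinAt_closure_of_tendsto_fderiv
      (fun x hx => ((hdiff m x hx).congr_of_eventuallyEq (heq x hx)).differentiableWithinAt)
      hc hV (fun x hx => (hcont m hm'.le x hx).mono subset_closure) ?_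
    have h1 := tendsto_extendFrom (hlim (m + 1) hm' q hq)
    refine (((continuousMultilinearCurryLeftEquiv ℝ (fun _ : Fin (m + 1) => E)
      F).continuous.tendsto _).comp h1).congr' ?_
    filter_upwards [self_mem_nhdsWithin] with x hx
    rw [(heq x hx).fderiv_eq]
    rfl
  exact hT.contDiffOn (n := (n : ℕ∞))

/-- Near `p` the extension by continuity is of class `C^n` for each `n`; the size of the
neighbourhood may depend on `n`, since the bounds on the derivatives are only asymptotic. -/
theorem BddDerivs.exists_ball_contDiffOn {U : Set E} (hU : IsOpen U) (hc : Convex ℝ U) {f : E → F}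
    {p : E} (hf : BddDerivs (𝓝[U] p) f) (n : ℕ) :
    ∃ r > 0, ContDiffOn ℝ n (extendFrom U f) (Metric.ball p r ∩ closure U) ∧
      ∀ q ∈ Metric.ball p r ∩ closure U, ∃ y, Tendsto f (𝓝[U] q) (𝓝 y) := by
  obtain ⟨C, -, hC⟩ := exists_bound_of_forall_isBigO (n := n + 1) fun i _ => hf.2 i
  obtain ⟨r, hr, hrU⟩ := Metric.mem_nhdsWithin_iff.1 (hf.1.and hC)
  obtain ⟨h1, h2⟩ := contDiffOn_extendFrom_of_bound (V := Metric.ball p r ∩ U)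
    (Metric.isOpen_ball.inter hU) ((convex_ball p r).inter hc) (f := f)
    (fun q hq => (hrU hq).1) (n := n) (C := C) (fun q hq => by simpa using (hrU hq).2)
  have hsub : Metric.ball p r ∩ closure U ⊆ closure (Metric.ball p r ∩ U) :=
    Metric.isOpen_ball.inter_closure
  have hnhds : ∀ q ∈ Metric.ball p r, 𝓝[Metric.ball p r ∩ U] q = 𝓝[U] q := fun q hq =>
    nhdsWithin_inter_of_mem (mem_nhdsWithin_of_mem_nhds (Metric.isOpen_ball.mem_nhds hq))
  refine ⟨r, hr, (h2.mono hsub).congr fun q hq => ?_, fun q hq => ?_⟩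
  · obtain ⟨y, hy⟩ := h1 q (hsub hq)
    rw [extendFrom_eq (hsub hq) hy, extendFrom_eq hq.2 (by rwa [hnhds q hq.1] at hy)]
  · simpa only [hnhds q hq.1] using h1 q (hsub hq)

theorem BddDerivs.exists_tendsto {U : Set E} (hU : IsOpen U) (hc : Convex ℝ U) {f : E → F}
    {p : E} (hp : p ∈ closure U) (hf : BddDerivs (𝓝[U] p) f) :
    ∃ y, Tendsto f (𝓝[U] p) (𝓝 y) := by
  obtain ⟨r, hr, -, h⟩ := hf.exists_ball_contDiffOn hU hc 0
  exact h p ⟨Metric.mem_ball_self hr, hp⟩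

/-- If all derivatives of `f` are bounded near the point `p` of the closure of the convex open set
`U`, then the extension of `f` by continuity is smooth at `p` up to the boundary. -/
theorem BddDerivs.contDiffWithinAt_extendFrom {U : Set E} (hU : IsOpen U) (hc : Convex ℝ U)
    {f : E → F} {p : E} (hp : p ∈ closure U) (hf : BddDerivs (𝓝[U] p) f) :
    ContDiffWithinAt ℝ ∞ (extendFrom U f) (closure U) p := by
  refine contDiffWithinAt_infty.2 fun n => ?_
  obtain ⟨r, hr, h, -⟩ := hf.exists_ball_contDiffOn hU hc n
  exact (h p ⟨Metric.mem_ball_self hr, hp⟩).mono_of_mem_nhdsWithin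
    (inter_mem (mem_nhdsWithin_of_mem_nhds (Metric.ball_mem_nhds p hr)) self_mem_nhdsWithin)

end Extension

/-! ### Total derivatives and mixed partial derivatives -/

section Mixed

variable {E F X Y : Type*} [NormedAddCommGroup E] [NormedSpace ℝ E] [NormedAddCommGroup F]
  [NormedSpace ℝ F] [NormedAddCommGroup X] [NormedSpace ℝ X] [NormedAddCommGroup Y]
  [NormedSpace ℝ Y]

/-- The iterated directional derivative of `f` along the vectors of a list, the last one first. -/
noncomputable def dirDerivs (f : E → F) : List E → E → F
  | [] => f
  | v :: L => fun p => fderiv ℝ (dirDerivs f L) p v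

theorem contDiff_dirDerivs {f : E → F} (hf : ContDiff ℝ ∞ f) (L : List E) :
    ContDiff ℝ ∞ (dirDerivs f L) := by
  induction L with
  | nil => exact hf
  | cons v L ih => exact (ih.fderiv_right (by simp)).clm_apply contDiff_const

theorem dirDerivs_append (f : E → F) (L L' : List E) :
    dirDerivs f (L ++ L') = dirDerivs (dirDerivs f L') L := by
  induction L with
  | nil => rfl
  | cons v L ih => simp only [List.cons_append, dirDerivs, ih]

theorem iteratedFDeriv_apply_eq_dirDerivs {f : E → F} (hf : ContDiff ℝ ∞ f) (n : ℕ)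
    (v : Fin n → E) (p : E) : iteratedFDeriv ℝ n f p v = dirDerivs f (List.ofFn v) p := by
  induction n generalizing p with
  | zero => simp [dirDerivs]
  | succ n ih =>
    have hd : DifferentiableAt ℝ (iteratedFDeriv ℝ n f) p :=
      hf.contDiffAt.differentiableAt_iteratedFDeriv (by exact_mod_cast ENat.natCast_lt_top n)
    rw [hd.iteratedFDeriv_succ_apply_left', List.ofFn_succ]
    simp only [ih, dirDerivs]
    rfl

/-- Iterated directional derivatives of a smooth function commute. -/
theorem dirDerivs_perm {f : E → F} (hf : ContDiff ℝ ∞ f) {L L' : List E} (h : L.Perm L') :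
    dirDerivs f L = dirDerivs f L' := by
  induction h with
  | nil => rfl
  | cons v _ ih => simp only [dirDerivs, ih]
  | trans _ _ ih ih' => exact ih.trans ih'
  | swap v w L =>
    ext p
    have hg := contDiff_dirDerivs hf L
    have hsymm : IsSymmSndFDerivAt ℝ (dirDerivs f L) p :=
      hg.contDiffAt.isSymmSndFDerivAt (by
        rw [minSmoothness_of_isRCLikeNormedField]
        exact WithTop.coe_le_coe.2 le_top)
    have hd : DifferentiableAt ℝ (fderiv ℝ (dirDerivs f L)) p :=
      (hg.fderiv_right (m := ∞) (by simp)).contDiffAt.differentiableAt (by simp)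
    have key : ∀ v w : E, fderiv ℝ (fun q => fderiv ℝ (dirDerivs f L) q v) p w
        = fderiv ℝ (fderiv ℝ (dirDerivs f L)) p w v := fun v w => by
      rw [fderiv_clm_apply hd (differentiableAt_const v)]
      simp
    simp only [dirDerivs, key]
    exact hsymm.eq w v

theorem dirDerivs_comp_affine {f : E → F} (hf : ContDiff ℝ ∞ f) (A : X →L[ℝ] E) (c : E)
    (L : List X) (x : X) :
    dirDerivs (fun x' => f (A x' + c)) L x = dirDerivs f (L.map A) (A x + c) := by
  induction L generalizing x with
  | nil => rfl
  | cons v L ih =>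
    have hd : DifferentiableAt ℝ (dirDerivs f (L.map A)) (A x + c) :=
      (contDiff_dirDerivs hf _).contDiffAt.differentiableAt (by simp)
    have h1 : HasFDerivAt (fun x' => A x' + c) A x := A.hasFDerivAt.add_const c
    simp only [dirDerivs, List.map_cons, funext ih]
    have h2 : HasFDerivAt (fun x' => dirDerivs f (L.map A) (A x' + c)) _ x :=
      hd.hasFDerivAt.comp x h1
    rw [h2.fderiv]
    rfl

theorem iteratedFDeriv_comp_affine {f : E → F} (hf : ContDiff ℝ ∞ f) (A : X →L[ℝ] E) (c : E)
    (j : ℕ) (x : X) :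
    iteratedFDeriv ℝ j (fun x' => f (A x' + c)) x =
      (iteratedFDeriv ℝ j f (A x + c)).compContinuousLinearMap fun _ => A := by
  ext v
  have hf' : ContDiff ℝ ∞ (fun x' => f (A x' + c)) := hf.comp (A.contDiff.add contDiff_const)
  rw [iteratedFDeriv_apply_eq_dirDerivs hf', dirDerivs_comp_affine hf,
    ContinuousMultilinearMap.compContinuousLinearMap_apply, iteratedFDeriv_apply_eq_dirDerivs hf,
    List.map_ofFn]
  rfl

/-- The mixed derivative in which `y` is differentiated last, as a directional derivative along
vectors of the two factors. -/
theorem iteratedFDeriv_mixed_apply {f : X × Y → F} (hf : ContDiff ℝ ∞ f) (j k : ℕ) (x : X) (y : Y)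
    (v : Fin j → X) (u : Fin k → Y) :
    iteratedFDeriv ℝ k (fun y' => iteratedFDeriv ℝ j (fun x' => f (x', y')) x) y u v =
      dirDerivs f ((List.ofFn u).map (ContinuousLinearMap.inr ℝ X Y) ++
        (List.ofFn v).map (ContinuousLinearMap.inl ℝ X Y)) (x, y) := by
  have hX : ∀ (g : X × Y → F) (y' : Y), (fun x' => g (x', y')) =
      fun x' => g (ContinuousLinearMap.inl ℝ X Y x' + (0, y')) := fun g y' => by ext; simp
  have hY : ∀ g : X × Y → F, (fun y' => g (x, y')) =
      fun y' => g (ContinuousLinearMap.inr ℝ X Y y' + (x, 0)) := fun g => by ext; simp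
  have hXs : ∀ y', ContDiff ℝ ∞ (fun x' => f (x', y')) := fun y' =>
    hf.comp (contDiff_id.prodMk contDiff_const)
  have hA : ContDiff ℝ ∞ (fun y' => iteratedFDeriv ℝ j (fun x' => f (x', y')) x) := by
    have h1 : (fun y' => iteratedFDeriv ℝ j (fun x' => f (x', y')) x) = fun y' =>
        ContinuousMultilinearMap.compContinuousLinearMapL
          (fun _ : Fin j => ContinuousLinearMap.inl ℝ X Y) (iteratedFDeriv ℝ j f (x, y')) := by
      ext1 y'
      rw [hX f y', iteratedFDeriv_comp_affine hf]
      ext v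
      simp
    rw [h1]
    refine ContinuousLinearMap.contDiff _ |>.comp ?_
    exact (hf.iteratedFDeriv_right (m := ∞) (WithTop.coe_le_coe.2 le_top)).comp
      (contDiff_const.prodMk contDiff_id)
  have h2 : iteratedFDeriv ℝ k (fun y' => iteratedFDeriv ℝ j (fun x' => f (x', y')) x) y u v =
      iteratedFDeriv ℝ k (fun y' => iteratedFDeriv ℝ j (fun x' => f (x', y')) x v) y u := by
    have := (ContinuousMultilinearMap.apply ℝ (fun _ : Fin j => X) F v).iteratedFDeriv_comp_left
      (f := fun y' => iteratedFDeriv ℝ j (fun x' => f (x', y')) x) (x := y) (n := ∞)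
      hA.contDiffAt (i := k) (by exact_mod_cast le_top)
    exact (congrArg (fun T => T u) this).symm
  have h3 : (fun y' => iteratedFDeriv ℝ j (fun x' => f (x', y')) x v) = fun y' =>
      dirDerivs f ((List.ofFn v).map (ContinuousLinearMap.inl ℝ X Y)) (x, y') := by
    ext1 y'
    rw [iteratedFDeriv_apply_eq_dirDerivs (hXs y'), hX f y', dirDerivs_comp_affine hf]
    simp
  have hg := contDiff_dirDerivs hf ((List.ofFn v).map (ContinuousLinearMap.inl ℝ X Y))
  have hg' : ContDiff ℝ ∞ fun y' =>
      dirDerivs f ((List.ofFn v).map (ContinuousLinearMap.inl ℝ X Y)) (x, y') :=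
    hg.comp (contDiff_const.prodMk contDiff_id)
  rw [h2, h3, iteratedFDeriv_apply_eq_dirDerivs hg',
    hY, dirDerivs_comp_affine hg, dirDerivs_append]
  simp

theorem exists_perm_inr_append_inl (L : List (X × Y)) (hL : ∀ z ∈ L, z.1 = 0 ∨ z.2 = 0) :
    ∃ (us : List Y) (vs : List X), L.Perm (us.map (ContinuousLinearMap.inr ℝ X Y) ++
      vs.map (ContinuousLinearMap.inl ℝ X Y)) := by
  induction L with
  | nil => exact ⟨[], [], by simp⟩
  | cons z L ih =>
    obtain ⟨us, vs, h⟩ := ih fun z hz => hL z (List.mem_cons_of_mem _ hz)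
    rcases hL z List.mem_cons_self with h0 | h0
    · refine ⟨z.2 :: us, vs, ?_⟩
      have : (ContinuousLinearMap.inr ℝ X Y) z.2 = z := by ext <;> simp [h0]
      simpa only [List.map_cons, List.cons_append, this] using h.cons z
    · refine ⟨us, z.1 :: vs, ?_⟩
      have : (ContinuousLinearMap.inl ℝ X Y) z.1 = z := by ext <;> simp [h0]
      simpa only [List.map_cons, this] using (h.cons z).trans List.perm_middle.symm

/-- The total derivative of order `n` is controlled by the mixed partial derivatives of order `n`
taken in one fixed order, since directional derivatives commute. -/
theorem norm_iteratedFDeriv_le_of_mixed {f : X × Y → F} (hf : ContDiff ℝ ∞ f) {n : ℕ} {x : X}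
    {y : Y} {M : ℝ}
    (hM : ∀ j k, j + k = n →
      ‖iteratedFDeriv ℝ k (fun y' => iteratedFDeriv ℝ j (fun x' => f (x', y')) x) y‖ ≤ M) :
    ‖iteratedFDeriv ℝ n f (x, y)‖ ≤ 2 ^ n * M := by
  have hM0 : 0 ≤ M := (norm_nonneg _).trans (hM n 0 rfl)
  have key : ∀ L : List (X × Y), L.length = n → (∀ z ∈ L, z.1 = 0 ∨ z.2 = 0) →
      ‖dirDerivs f L (x, y)‖ ≤ M * (L.map norm).prod := by
    intro L hn hL
    obtain ⟨us, vs, h⟩ := exists_perm_inr_append_inl L hL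
    have hlen := h.length_eq
    simp only [List.length_append, List.length_map] at hlen
    rw [dirDerivs_perm hf h, (h.map norm).prod_eq]
    have h1 := iteratedFDeriv_mixed_apply hf vs.length us.length x y vs.get us.get
    rw [List.ofFn_get, List.ofFn_get] at h1
    rw [← h1]
    have hu : (us.map norm).prod = ∏ i, ‖us.get i‖ := by
      rw [← List.prod_ofFn, ← Function.comp_def norm, ← List.map_ofFn, List.ofFn_get]
    have hv : (vs.map norm).prod = ∏ i, ‖vs.get i‖ := by
      rw [← List.prod_ofFn, ← Function.comp_def norm, ← List.map_ofFn, List.ofFn_get]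
    have hnr : (norm ∘ ⇑(ContinuousLinearMap.inr ℝ X Y)) = norm := by
      ext; simp [Prod.norm_def]
    have hnl : (norm ∘ ⇑(ContinuousLinearMap.inl ℝ X Y)) = norm := by
      ext; simp [Prod.norm_def]
    rw [List.map_append, List.prod_append, List.map_map, List.map_map, hnr, hnl, hu, hv]
    refine (ContinuousMultilinearMap.le_opNorm _ _).trans ?_
    rw [← mul_assoc]
    gcongr
    refine (ContinuousMultilinearMap.le_opNorm _ _).trans ?_
    gcongr
    exact hM _ _ (by omega)
  refine ContinuousMultilinearMap.opNorm_le_bound (by positivity) fun m => ?_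
  -- each of the `2 ^ n` terms of the multilinear expansion has its arguments in the two factors
  have hsplit : m = (fun i => ((m i).1, 0)) + fun i => (0, (m i).2) := by
    ext i <;> simp
  conv_lhs => rw [hsplit, ContinuousMultilinearMap.map_add_univ]
  refine (norm_sum_le_of_le (n := fun _ => M * ∏ i, ‖m i‖) _ fun s _ => ?_).trans ?_
  · rw [iteratedFDeriv_apply_eq_dirDerivs hf]
    refine (key _ (List.length_ofFn) fun z hz => ?_).trans ?_
    · obtain ⟨i, rfl⟩ := List.mem_ofFn.1 hz
      by_cases hi : i ∈ s <;> simp [hi]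
    · rw [List.map_ofFn, List.prod_ofFn]
      refine mul_le_mul_of_nonneg_left
        (Finset.prod_le_prod (fun i _ => norm_nonneg _) fun i _ => ?_) hM0
      by_cases hi : i ∈ s <;> simp [hi, Prod.norm_def]
  · simp [mul_assoc]

end Mixed

/-! ### Symbol estimates for total derivatives -/

section Symbols

variable {d s : ℕ} {W : Type*} [NormedAddCommGroup W] [NormedSpace ℝ W]

theorem one_le_jap {n : ℕ} (x : Eu n) : 1 ≤ jap x :=
  Real.one_le_sqrt.2 (by nlinarith [sq_nonneg ‖x‖])

theorem jap_pos {n : ℕ} (x : Eu n) : 0 < jap x := zero_lt_one.trans_le (one_le_jap x)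

theorem norm_le_jap {n : ℕ} (x : Eu n) : ‖x‖ ≤ jap x :=
  Real.le_sqrt_of_sq_le (by linarith)

theorem jap_le_one_add_norm {n : ℕ} (x : Eu n) : jap x ≤ 1 + ‖x‖ :=
  Real.sqrt_le_iff.2 ⟨by positivity, by nlinarith [norm_nonneg x]⟩

/-- The part of the symbol estimates of order `(m, l)` that is used at the boundary: the total
derivatives of all orders are bounded by `⟨x⟩^m ⟨θ⟩^l`, with no gain from differentiation. -/
def SymbolBounds (m l : ℝ) (a : Eu d × Eu s → W) : Prop :=
  ContDiff ℝ ∞ a ∧ ∀ n : ℕ, ∃ C : ℝ, ∀ z, ‖iteratedFDeriv ℝ n a z‖ ≤ C * (jap z.1 ^ m * jap z.2 ^ l)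

theorem IsSGSymbol.symbolBounds {m l : ℝ} {a : Eu d → Eu s → W} (ha : IsSGSymbol m l a) :
    SymbolBounds m l fun z => a z.1 z.2 := by
  refine ⟨ha.1, fun n => ?_⟩
  choose C hC using ha.2
  refine ⟨2 ^ n * ∑ j ∈ Finset.range (n + 1), |C j (n - j)|, fun z => ?_⟩
  rw [mul_assoc]
  refine norm_iteratedFDeriv_le_of_mixed (x := z.1) (y := z.2) ha.1 fun j k hjk => ?_
  have hj : j ∈ Finset.range (n + 1) := Finset.mem_range.2 (by omega)
  obtain rfl : k = n - j := by omega
  have h1 : jap z.1 ^ (m - j) ≤ jap z.1 ^ m :=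
    Real.rpow_le_rpow_of_exponent_le (one_le_jap _) (by simp)
  have h2 : jap z.2 ^ (l - (n - j : ℕ)) ≤ jap z.2 ^ l :=
    Real.rpow_le_rpow_of_exponent_le (one_le_jap _) (by simp)
  have := (jap_pos z.1).le
  have := (jap_pos z.2).le
  calc _ ≤ C j (n - j) * jap z.1 ^ (m - j) * jap z.2 ^ (l - (n - j : ℕ)) := hC j (n - j) z.1 z.2
    _ ≤ |C j (n - j)| * jap z.1 ^ m * jap z.2 ^ l := by
      gcongr
      exact le_abs_self _
    _ ≤ _ := by
      rw [mul_assoc]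
      gcongr
      exact Finset.single_le_sum (f := fun j => |C j (n - j)|) (fun _ _ => abs_nonneg _) hj

theorem SymbolBounds.swap {m l : ℝ} {a : Eu d × Eu s → W} (ha : SymbolBounds m l a) :
    SymbolBounds l m (a ∘ Prod.swap) := by
  refine ⟨ha.1.comp (contDiff_snd.prodMk contDiff_fst), fun n => (ha.2 n).imp fun C hC z => ?_⟩
  have := (LinearIsometryEquiv.prodComm ℝ (Eu s) (Eu d)).norm_iteratedFDeriv_comp_right
    (𝕜 := ℝ) a z n
  refine (le_of_eq this).trans ((hC _).trans (le_of_eq ?_))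
  simp [mul_comm]

/-- `a` has a polyhomogeneous expansion of order `l` in its second variable, with excision function
`χ` and coefficients `A k`, the remainders being controlled in the sense of `SymbolBounds`. -/
structure PolyhomExpansion (m l : ℝ) (a : Eu d × Eu s → W) (χ : Eu s → ℝ)
    (A : ℕ → Eu d × Eu s → W) : Prop where
  excision : IsExcision χ
  smooth : ∀ k, ContDiffOn ℝ ∞ (A k) (Set.univ ×ˢ {0}ᶜ)
  homog : ∀ (k : ℕ) (x : Eu d) (θ : Eu s) (t : ℝ), θ ≠ 0 → 0 < t →
    A k (x, t • θ) = t ^ (l - k) • A k (x, θ)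
  remainder : ∀ N : ℕ, SymbolBounds m (l - N)
    fun z => a z - ∑ k ∈ Finset.range N, χ z.2 • A k z

theorem polyhomExpansion_theta {m l : ℝ} {a : Eu d → Eu s → W} {χ : Eu s → ℝ}
    {A : ℕ → Eu d → Eu s → W} (hχ : IsExcision χ) (hA : ∀ k : ℕ, IsHomogTheta (l - k) (A k))
    (h : HasExpansionTheta m l a χ A) :
    PolyhomExpansion m l (fun z => a z.1 z.2) χ fun k z => A k z.1 z.2 :=
  ⟨hχ, fun k => (hA k).1, fun k => (hA k).2, fun N => (h N).symbolBounds⟩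

/-- An expansion in `x` is an expansion in the second variable after exchanging the variables. -/
theorem polyhomExpansion_x {m l : ℝ} {a : Eu d → Eu s → W} {χ : Eu d → ℝ}
    {A : ℕ → Eu d → Eu s → W} (hχ : IsExcision χ) (hA : ∀ j : ℕ, IsHomogX (m - j) (A j))
    (h : HasExpansionX m l a χ A) :
    PolyhomExpansion l m (fun z => a z.2 z.1) χ fun k z => A k z.2 z.1 :=
  ⟨hχ, fun k => (hA k).1.comp (contDiff_snd.prodMk contDiff_fst).contDiffOn
    fun _ hz => ⟨hz.2, hz.1⟩, fun k x θ t => (hA k).2 θ x t,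
    fun N => (h N).symbolBounds.swap⟩

end Symbols

/-! ### The inverse of the radial compactification near the sphere -/

section Radial

theorem RadialDiffeo.inv_eq {n : ℕ} (ι : RadialDiffeo n) {y : Eu n} (h1 : 2 / 3 < ‖y‖)
    (h2 : ‖y‖ < 1) : ι.inv y = (1 - ‖y‖)⁻¹ • (‖y‖⁻¹ • y) := by
  have hy : ‖y‖ ≠ 0 := by linarith
  have hρ : 0 < 1 - ‖y‖ := by linarith
  set x : Eu n := (1 - ‖y‖)⁻¹ • (‖y‖⁻¹ • y) with hx
  have hnx : ‖x‖ = (1 - ‖y‖)⁻¹ := by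
    rw [hx, norm_smul, norm_smul, norm_inv, norm_inv, norm_norm, inv_mul_cancel₀ hy, mul_one,
      Real.norm_of_nonneg hρ.le]
  have h3 : 3 < ‖x‖ := by
    rw [hnx, lt_inv_comm₀ (by norm_num) hρ]
    norm_num
    linarith
  have : ι.toFun x = y := by
    rw [ι.toFun_of_large x h3, hnx, hx, smul_smul, smul_smul, smul_smul]
    convert one_smul ℝ y
    field_simp
    ring
  rw [← this, ι.inv_toFun]

theorem RadialDiffeo.norm_inv_eq {n : ℕ} (ι : RadialDiffeo n) {y : Eu n} (h1 : 2 / 3 < ‖y‖)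
    (h2 : ‖y‖ < 1) : ‖ι.inv y‖ = (1 - ‖y‖)⁻¹ := by
  have hy : ‖y‖ ≠ 0 := by linarith
  have hρ : 0 < 1 - ‖y‖ := by linarith
  rw [ι.inv_eq h1 h2, norm_smul, norm_smul, norm_inv, norm_inv, norm_norm, inv_mul_cancel₀ hy,
    mul_one, Real.norm_of_nonneg hρ.le]

variable {E : Type*} [NormedAddCommGroup E] [NormedSpace ℝ E] {n : ℕ}

/-- The coordinate `π` tends to a point of the unit sphere from inside the unit ball as the filter
`l` tends to `p`. -/
structure ApproachesSphere (l : Filter E) (π : E →L[ℝ] Eu n) (p : E) : Prop where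
  le_nhds : l ≤ 𝓝 p
  norm_eq_one : ‖π p‖ = 1
  norm_lt_one : ∀ᶠ q in l, ‖π q‖ < 1

variable {l : Filter E} {π : E →L[ℝ] Eu n} {p : E}

theorem ApproachesSphere.mono (h : ApproachesSphere l π p) {l' : Filter E} (hl : l' ≤ l) :
    ApproachesSphere l' π p :=
  ⟨hl.trans h.le_nhds, h.norm_eq_one, hl h.norm_lt_one⟩

theorem ApproachesSphere.eventually_near (h : ApproachesSphere l π p) {ε : ℝ} (hε : 0 < ε) :
    ∀ᶠ q in l, ∀ᶠ q' in 𝓝 q, 1 - ε < ‖π q'‖ ∧ ‖π q'‖ < 1 := by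
  have hc : Continuous fun q => ‖π q‖ := π.continuous.norm
  have h1 : ∀ᶠ q in 𝓝 p, 1 - ε < ‖π q‖ :=
    hc.continuousAt.eventually (lt_mem_nhds (by simp only [h.norm_eq_one]; linarith))
  filter_upwards [h.le_nhds h1, h.norm_lt_one] with q h2 h3
  exact (hc.continuousAt.eventually (lt_mem_nhds h2)).and
    (hc.continuousAt.eventually (gt_mem_nhds h3))

theorem ApproachesSphere.eventually (h : ApproachesSphere l π p) {ε : ℝ} (hε : 0 < ε) :
    ∀ᶠ q in l, 1 - ε < ‖π q‖ ∧ ‖π q‖ < 1 :=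
  (h.eventually_near hε).mono fun _ hq => hq.self_of_nhds

theorem ApproachesSphere.ne_zero_near (h : ApproachesSphere l π p) : ∀ᶠ q in 𝓝 p, π q ≠ 0 :=
  π.continuous.continuousAt.eventually_ne (by
    intro h0
    have := h.norm_eq_one
    simp [h0] at this)

theorem ApproachesSphere.contDiffAt_norm_near (h : ApproachesSphere l π p) :
    ∀ᶠ q in 𝓝 p, ContDiffAt ℝ ∞ (fun q => ‖π q‖) q :=
  h.ne_zero_near.mono fun q hq => (contDiffAt_norm ℝ hq).comp q π.contDiff.contDiffAt

theorem ApproachesSphere.contDiffAt_direction_near (h : ApproachesSphere l π p) :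
    ∀ᶠ q in 𝓝 p, ContDiffAt ℝ ∞ (fun q => ‖π q‖⁻¹ • π q) q :=
  (h.contDiffAt_norm_near.and h.ne_zero_near).mono fun _ hq =>
    (hq.1.inv (norm_ne_zero_iff.2 hq.2)).smul π.contDiff.contDiffAt

theorem ApproachesSphere.bddDerivs_one_sub (h : ApproachesSphere l π p) :
    BddDerivs l fun q => 1 - ‖π q‖ :=
  BddDerivs.of_contDiffAt h.le_nhds (h.contDiffAt_norm_near.mono fun _ hq => contDiffAt_const.sub hq)

theorem ApproachesSphere.tame_rpow (h : ApproachesSphere l π p) {w : E → ℝ}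
    (hw : ∀ᶠ q in l, (1 - ‖π q‖)⁻¹ ≤ w q) (m : ℝ) :
    Tame w l fun q => (1 - ‖π q‖) ^ m := by
  have h0 : ∀ᶠ q in l, 0 < 1 - ‖π q‖ ∧ 1 - ‖π q‖ ≤ 1 :=
    h.norm_lt_one.mono fun q hq => ⟨by linarith, by linarith [norm_nonneg (π q)]⟩
  refine (h.bddDerivs_one_sub.tame w).rpow ?_ (h0.mono fun _ h => h.1) (h0.mono fun _ h => h.2) hw m
  filter_upwards [h0, hw] with q h1 h2
  exact ((one_le_inv₀ h1.1).2 h1.2).trans h2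

theorem ApproachesSphere.tame_inv (h : ApproachesSphere l π p) (ι : RadialDiffeo n) {w : E → ℝ}
    (hw : ∀ᶠ q in l, (1 - ‖π q‖)⁻¹ ≤ w q) :
    Tame w l fun q => ι.inv (π q) := by
  have h1w : ∀ᶠ q in l, 1 ≤ w q := by
    filter_upwards [h.norm_lt_one, hw] with q h1 h2
    exact ((one_le_inv₀ (by linarith)).2 (by linarith [norm_nonneg (π q)])).trans h2
  refine ((h.tame_rpow hw (-1)).smul h1w
    ((BddDerivs.of_contDiffAt h.le_nhds h.contDiffAt_direction_near).tame w)).congr ?_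
  filter_upwards [h.eventually_near (ε := 1 / 3) (by norm_num)] with q hq
  filter_upwards [hq] with q' hq'
  rw [ι.inv_eq (by linarith) hq'.2, Real.rpow_neg_one]

end Radial

/-! ### Weighted pullbacks of polyhomogeneous symbols -/

section Pullback

variable {E Z W : Type*} [NormedAddCommGroup E] [NormedSpace ℝ E] [NormedAddCommGroup Z]
  [NormedSpace ℝ Z] [NormedAddCommGroup W] [NormedSpace ℝ W]

/-- Pulling back by a tame map and multiplying by a tame function costs a power of the weight that
depends only on the order of the derivative, not on the function that is pulled back. -/
theorem Tame.exists_isBigO_smul_comp {l : Filter E} {w : E → ℝ} (hw : ∀ᶠ q in l, 1 ≤ w q)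
    {u : E → ℝ} {Φ : E → Z} (hu : Tame w l u) (hΦ : Tame w l Φ) (n : ℕ) :
    ∃ K : ℕ, ∀ (r : Z → W) (v : E → ℝ), ContDiff ℝ ∞ r →
      (∀ i ≤ n, (fun q => iteratedFDeriv ℝ i r (Φ q)) =O[l] v) →
      iteratedFDeriv ℝ n (fun q => u q • r (Φ q)) =O[l] fun q => w q ^ K * v q := by
  obtain ⟨K₁, hK₁⟩ := hΦ.exists_uniform hw n
  obtain ⟨K₂, hK₂⟩ := hu.exists_uniform hw n
  refine ⟨K₂ + K₁ * n, fun r v hr hv => ?_⟩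
  have h1 : ∀ i ≤ n, iteratedFDeriv ℝ i (r ∘ Φ) =O[l] fun q => v q * w q ^ (K₁ * n) := by
    intro i hi
    have := isBigO_iteratedFDeriv_comp (n := i) hΦ.1 (g := r)
      (Eventually.of_forall fun q => hr.contDiffAt) (u := fun q => w q ^ K₁)
      (hw.mono fun q hq => one_le_pow₀ hq) (fun j hj => hK₁ j (hj.trans hi))
      (fun j hj => hv j (hj.trans hi))
    refine this.trans ((isBigO_refl v l).mul ?_)
    simp only [← pow_mul]
    exact isBigO_pow_of_le hw (Nat.mul_le_mul_left _ hi)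
  have h2 := isBigO_iteratedFDeriv_bilinear (ContinuousLinearMap.lsmul ℝ ℝ (E := W)) hu.1
    (hΦ.1.mono fun q hq => hr.contDiffAt.comp q hq) hK₂ h1
  refine (h2.congr_right fun q => ?_)
  ring

variable {d s : ℕ}

/-- The remainders of high order in a polyhomogeneous expansion in `θ` absorb any power of the
weight `1 / (1 - |γ|)`, so bounds on the derivatives of the weighted pullback reduce to the
coefficients of the expansion, restricted to the unit sphere. -/
theorem PolyhomExpansion.bddDerivs {m r : ℝ} {a : Eu d × Eu s → W} {χ : Eu s → ℝ}
    {A : ℕ → Eu d × Eu s → W} (ha : PolyhomExpansion m r a χ A) (ι : RadialDiffeo s)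
    {l : Filter E} {π : E →L[ℝ] Eu s} {p : E} (hl : ApproachesSphere l π p)
    {f : E → Eu d} {u : E → ℝ} (hf : Tame (fun q => (1 - ‖π q‖)⁻¹) l f)
    (hu : Tame (fun q => (1 - ‖π q‖)⁻¹) l u)
    (hcoef : ∀ k, BddDerivs l fun q => u q • A k (f q, ‖π q‖⁻¹ • π q)) :
    BddDerivs l fun q => (u q * (1 - ‖π q‖) ^ r) • a (f q, ι.inv (π q)) := by
  set w : E → ℝ := fun q => (1 - ‖π q‖)⁻¹
  have hρ : ∀ᶠ q in l, 0 < 1 - ‖π q‖ := hl.norm_lt_one.mono fun q hq => by linarith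
  have hw : ∀ᶠ q in l, 1 ≤ w q := hρ.mono fun q hq =>
    (one_le_inv₀ hq).2 (by linarith [norm_nonneg (π q)])
  have hwle : ∀ᶠ q in l, (1 - ‖π q‖)⁻¹ ≤ w q := Eventually.of_forall fun q => le_rfl
  have hκ := hl.tame_inv ι hwle
  have hΦ : Tame w l fun q => (f q, ι.inv (π q)) := hf.prodMk hw hκ
  have hU : Tame w l fun q => u q * (1 - ‖π q‖) ^ r := hu.smul hw (hl.tame_rpow hwle r)
  have hsmooth : ContDiff ℝ ∞ a := by simpa using (ha.remainder 0).1
  refine ⟨?_, fun n => ?_⟩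
  · filter_upwards [hU.1, hΦ.1] with q h1 h2
    exact h1.smul (hsmooth.contDiffAt.comp q h2)
  obtain ⟨K, hK⟩ := hU.exists_isBigO_smul_comp (W := W) hw hΦ n
  -- `⟨f⟩^m` grows at most like a power of the weight
  obtain ⟨K', C', hC', hK'⟩ : ∃ (K' : ℕ) (C' : ℝ), 0 ≤ C' ∧
      ∀ᶠ q in l, jap (f q) ^ m ≤ C' * w q ^ K' := by
    obtain ⟨K₀, hK₀⟩ := hf.2 0
    obtain ⟨C, hC0, hC⟩ := hK₀.exists_nonneg
    refine ⟨K₀ * ⌈|m|⌉₊, (1 + C) ^ ⌈|m|⌉₊, by positivity, ?_⟩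
    filter_upwards [hC.bound, hw] with q h1 h2
    rw [norm_iteratedFDeriv_zero, Real.norm_of_nonneg (by positivity)] at h1
    have h3 : (1 : ℝ) ≤ w q ^ K₀ := one_le_pow₀ h2
    calc jap (f q) ^ m ≤ jap (f q) ^ (⌈|m|⌉₊ : ℝ) :=
          Real.rpow_le_rpow_of_exponent_le (one_le_jap _) ((le_abs_self m).trans (Nat.le_ceil _))
      _ = jap (f q) ^ ⌈|m|⌉₊ := Real.rpow_natCast _ _
      _ ≤ ((1 + C) * w q ^ K₀) ^ ⌈|m|⌉₊ := by
          refine pow_le_pow_left₀ (jap_pos _).le ?_ _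
          refine (jap_le_one_add_norm _).trans ?_
          linarith
      _ = _ := by rw [mul_pow, pow_mul]
  -- `K` does not depend on the remainder, so enough terms of the expansion may be split off for
  -- the decay of the remainder to beat it
  obtain ⟨N, hN⟩ := exists_nat_ge (r + K + K')
  have hrem := hK _ (fun q => jap (f q) ^ m * jap (ι.inv (π q)) ^ (r - N)) (ha.remainder N).1
    fun i _ => by
      obtain ⟨C, hC⟩ := (ha.remainder N).2 i
      refine IsBigO.of_bound C (Eventually.of_forall fun q => ?_)
      have h1 := jap_pos (f q)
      have h2 := jap_pos (ι.inv (π q))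
      rw [Real.norm_of_nonneg (by positivity)]
      exact hC _
  have hrem' : iteratedFDeriv ℝ n (fun q => (u q * (1 - ‖π q‖) ^ r) •
      (a (f q, ι.inv (π q)) - ∑ k ∈ Finset.range N, χ (ι.inv (π q)) • A k (f q, ι.inv (π q))))
        =O[l] fun _ => (1 : ℝ) := by
    refine hrem.trans (IsBigO.of_bound C' ?_)
    filter_upwards [hw, hK', hl.eventually (ε := 1 / 3) (by norm_num)] with q h1 h2 h3
    have h0 : 0 < w q := by linarith
    have hj1 := jap_pos (f q)
    have hj2 := jap_pos (ι.inv (π q))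
    have h4 : w q ≤ jap (ι.inv (π q)) := by
      refine le_trans (le_of_eq ?_) (norm_le_jap _)
      exact (ι.norm_inv_eq (by linarith) h3.2).symm
    rw [Real.norm_of_nonneg (by positivity), norm_one, mul_one]
    calc w q ^ K * (jap (f q) ^ m * jap (ι.inv (π q)) ^ (r - N))
        ≤ w q ^ K * (C' * w q ^ K' * w q ^ (-(K + K') : ℝ)) := by
          gcongr
          exact (Real.rpow_le_rpow_of_nonpos h0 h4 (by
            have : (0 : ℝ) ≤ K + K' := by positivity
            linarith)).trans
            (Real.rpow_le_rpow_of_exponent_le h1 (by linarith))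
      _ = C' * (w q ^ (K + K' : ℝ) * w q ^ (-(K + K') : ℝ)) := by
          rw [Real.rpow_add h0, Real.rpow_natCast, Real.rpow_natCast]
          ring
      _ = C' := by rw [← Real.rpow_add h0]; simp
  have hsum : BddDerivs l fun q => (u q * (1 - ‖π q‖) ^ r) •
      ∑ k ∈ Finset.range N, χ (ι.inv (π q)) • A k (f q, ι.inv (π q)) := by
    obtain ⟨R, hR⟩ := ha.excision.2.2
    have hR0 : 0 < 1 / (3 + |R|) := by positivity
    -- by homogeneity the `k`-th term is `(1 - |γ|) ^ k` times the coefficient on the unit sphere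
    have hterm : BddDerivs l fun q => ∑ k ∈ Finset.range N,
        (1 - ‖π q‖) ^ k • (u q • A k (f q, ‖π q‖⁻¹ • π q)) :=
      BddDerivs.sum _ fun k _ => BddDerivs.smul (BddDerivs.of_contDiffAt hl.le_nhds
        (hl.contDiffAt_norm_near.mono fun _ hq => (contDiffAt_const.sub hq).pow k)) (hcoef k)
    refine hterm.congr ?_
    filter_upwards [hl.eventually_near hR0] with q hq
    filter_upwards [hq] with q' hq'
    have h3R : 1 / (3 + |R|) ≤ 1 / 3 := by
      gcongr
      linarith [abs_nonneg R]
    have hρ' : 0 < 1 - ‖π q'‖ := by linarith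
    have hπ : 2 / 3 < ‖π q'‖ := by linarith
    have hne : ‖π q'‖⁻¹ • π q' ≠ 0 := by
      have : ‖π q'‖ ≠ 0 := by linarith
      exact smul_ne_zero (inv_ne_zero this) (norm_ne_zero_iff.1 this)
    have hχ : χ (ι.inv (π q')) = 1 := hR _ <| by
      rw [ι.norm_inv_eq hπ hq'.2]
      have h1 : 1 - ‖π q'‖ ≤ 1 / (3 + |R|) := by linarith
      have h2 := one_div_le_one_div_of_le hρ' h1
      rw [one_div_one_div, one_div] at h2
      linarith [le_abs_self R]
    rw [Finset.smul_sum]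
    refine Finset.sum_congr rfl fun k _ => ?_
    rw [hχ, one_smul, ι.inv_eq hπ hq'.2, ha.homog k _ _ _ hne (inv_pos.2 hρ'), smul_smul, smul_smul]
    congr 1
    rw [Real.inv_rpow hρ'.le, Real.rpow_sub hρ', Real.rpow_natCast]
    have : (1 - ‖π q'‖) ^ r ≠ 0 := (Real.rpow_pos_of_pos hρ' r).ne'
    field_simp
  have hrem_smooth : ∀ᶠ q in l, ContDiffAt ℝ ∞ (fun q => (u q * (1 - ‖π q‖) ^ r) •
      (a (f q, ι.inv (π q)) - ∑ k ∈ Finset.range N, χ (ι.inv (π q)) • A k (f q, ι.inv (π q)))) q := by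
    filter_upwards [hU.1, hΦ.1] with q h1 h2
    exact h1.smul ((ha.remainder N).1.contDiffAt.comp q h2)
  refine (hrem'.add (hsum.2 n)).congr' ?_ EventuallyEq.rfl
  filter_upwards [hrem_smooth, hsum.1] with q h1 h2
  rw [← iteratedFDeriv_add_apply (h1.of_le (by exact_mod_cast le_top))
    (h2.of_le (by exact_mod_cast le_top))]
  congr 1
  ext q'
  simp [smul_sub]

end Pullback

section Faces

variable {E W : Type*} [NormedAddCommGroup E] [NormedSpace ℝ E] [NormedAddCommGroup W]
  [NormedSpace ℝ W] {d s : ℕ}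

/-- Away from the corner the first variable enters through a smooth map, and the coefficients of
the expansion are smooth near the point in question. -/
theorem PolyhomExpansion.bddDerivs_face {m r : ℝ} {a : Eu d × Eu s → W} {χ : Eu s → ℝ}
    {A : ℕ → Eu d × Eu s → W} (ha : PolyhomExpansion m r a χ A) (ι : RadialDiffeo s)
    {l : Filter E} {π : E →L[ℝ] Eu s} {p : E} (hl : ApproachesSphere l π p)
    {g : E → Eu d} (hg : ∀ᶠ q in 𝓝 p, ContDiffAt ℝ ∞ g q) :
    BddDerivs l fun q => (1 - ‖π q‖) ^ r • a (g q, ι.inv (π q)) := by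
  have h := ha.bddDerivs ι hl ((BddDerivs.of_contDiffAt hl.le_nhds hg).tame _)
    ((BddDerivs.const l (1 : ℝ)).tame _) fun k => ?_
  · simpa using h
  · simp only [one_smul]
    refine BddDerivs.of_contDiffAt hl.le_nhds ?_
    filter_upwards [hg, hl.contDiffAt_direction_near, hl.ne_zero_near] with q h1 h2 h3
    have h4 : ContDiffAt ℝ ∞ (A k) (g q, ‖π q‖⁻¹ • π q) :=
      (ha.smooth k).contDiffAt ((isOpen_univ.prod isOpen_compl_singleton).mem_nhds
        ⟨Set.mem_univ _, smul_ne_zero (inv_ne_zero (norm_ne_zero_iff.2 h3)) h3⟩)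
    exact h4.comp q (h1.prodMk h2)

/-- Near the corner, in the region where `γ` is the closer of the two variables to its sphere, the
expansion in `θ` alone suffices. -/
theorem PolyhomExpansion.bddDerivs_corner_of_le {m r : ℝ} {a : Eu d × Eu s → W} {χ : Eu s → ℝ}
    {A : ℕ → Eu d × Eu s → W} (ha : PolyhomExpansion m r a χ A)
    (hA : ∀ k : ℕ, ∃ (χ' : Eu d → ℝ) (A' : ℕ → Eu s × Eu d → W),
      PolyhomExpansion (r - k) m (fun z => χ z.1 • A k (z.2, z.1)) χ' A')
    (ιd : RadialDiffeo d) (ιs : RadialDiffeo s)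
    {l : Filter E} {π₁ : E →L[ℝ] Eu d} {π₂ : E →L[ℝ] Eu s} {p : E}
    (h₁ : ApproachesSphere l π₁ p) (h₂ : ApproachesSphere l π₂ p)
    (hle : ∀ᶠ q in l, 1 - ‖π₂ q‖ ≤ 1 - ‖π₁ q‖) :
    BddDerivs l fun q => ((1 - ‖π₁ q‖) ^ m * (1 - ‖π₂ q‖) ^ r) •
      a (ιd.inv (π₁ q), ιs.inv (π₂ q)) := by
  have hw : ∀ᶠ q in l, (1 - ‖π₁ q‖)⁻¹ ≤ (1 - ‖π₂ q‖)⁻¹ := by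
    filter_upwards [hle, h₂.norm_lt_one] with q h3 h4
    exact inv_anti₀ (by linarith) h3
  refine ha.bddDerivs ιs h₂ (h₁.tame_inv ιd hw) (h₁.tame_rpow hw m) fun k => ?_
  obtain ⟨χ', A', hk⟩ := hA k
  obtain ⟨R, hR⟩ := ha.excision.2.2
  have hT : 0 < 1 + |R| := by positivity
  -- the coefficient is evaluated on the sphere of radius `1 + |R|`, where `χ = 1`
  have key := hk.bddDerivs_face ιd h₁ (g := fun q => (1 + |R|) • (‖π₂ q‖⁻¹ • π₂ q))
    (h₂.contDiffAt_direction_near.mono fun q hq => hq.const_smul (1 + |R|))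
  refine (BddDerivs.smul (BddDerivs.const l ((1 + |R|) ^ (r - k))⁻¹) key).congr ?_
  filter_upwards [h₂.le_nhds (eventually_eventually_nhds.2 h₂.ne_zero_near)] with q hq
  filter_upwards [hq] with q' hq'
  have hne : ‖π₂ q'‖ ≠ 0 := norm_ne_zero_iff.2 hq'
  have hdir : ‖π₂ q'‖⁻¹ • π₂ q' ≠ 0 := smul_ne_zero (inv_ne_zero hne) hq'
  have hχ : χ ((1 + |R|) • (‖π₂ q'‖⁻¹ • π₂ q')) = 1 := hR _ <| by
    rw [norm_smul, norm_smul, norm_inv, norm_norm, inv_mul_cancel₀ hne, mul_one,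
      Real.norm_of_nonneg hT.le]
    linarith [le_abs_self R]
  rw [hχ, one_smul, ha.homog k _ _ _ hdir hT, smul_smul, smul_smul]
  congr 1
  have : (1 + |R|) ^ (r - k) ≠ 0 := (Real.rpow_pos_of_pos hT _).ne'
  field_simp

variable {m r : ℝ} {a : Eu d → Eu s → W} {l : Filter E} {π₁ : E →L[ℝ] Eu d} {π₂ : E →L[ℝ] Eu s}
  {p : E}

theorem IsSGClassical.bddDerivs_theta (ha : IsSGClassical m r a) (ιs : RadialDiffeo s)
    (h₂ : ApproachesSphere l π₂ p) {g : E → Eu d} (hg : ∀ᶠ q in 𝓝 p, ContDiffAt ℝ ∞ g q) :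
    BddDerivs l fun q => (1 - ‖π₂ q‖) ^ r • a (g q) (ιs.inv (π₂ q)) := by
  obtain ⟨χ, A, hχ, hA, h⟩ := ha.2
  exact (polyhomExpansion_theta hχ (fun k => (hA k).1) h).bddDerivs_face ιs h₂ hg

theorem IsSGClassical.bddDerivs_x (ha : IsSGClassical m r a) (ιd : RadialDiffeo d)
    (h₁ : ApproachesSphere l π₁ p) {g : E → Eu s} (hg : ∀ᶠ q in 𝓝 p, ContDiffAt ℝ ∞ g q) :
    BddDerivs l fun q => (1 - ‖π₁ q‖) ^ m • a (ιd.inv (π₁ q)) (g q) := by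
  obtain ⟨χ, A, hχ, hA, h⟩ := ha.1
  exact (polyhomExpansion_x hχ (fun k => (hA k).1) h).bddDerivs_face ιd h₁ hg

/-- At the corner the neighbourhood is split according to which of the two boundary defining
functions is smaller; the expansion in the corresponding variable controls each part, and no
compatibility between the two expansions is needed. -/
theorem IsSGClassical.bddDerivs_corner (ha : IsSGClassical m r a) (ιd : RadialDiffeo d)
    (ιs : RadialDiffeo s) (h₁ : ApproachesSphere l π₁ p) (h₂ : ApproachesSphere l π₂ p) :
    BddDerivs l fun q => ((1 - ‖π₁ q‖) ^ m * (1 - ‖π₂ q‖) ^ r) •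
      a (ιd.inv (π₁ q)) (ιs.inv (π₂ q)) := by
  set S : Set E := {q | 1 - ‖π₂ q‖ ≤ 1 - ‖π₁ q‖}
  have hl : l = l ⊓ 𝓟 S ⊔ l ⊓ 𝓟 Sᶜ := by
    rw [← inf_sup_left, sup_principal, Set.union_compl_self, principal_univ, inf_top_eq]
  rw [hl]
  refine BddDerivs.sup ?_ ?_
  · obtain ⟨χ, A, hχ, hA, h⟩ := ha.2
    refine (polyhomExpansion_theta hχ (fun k => (hA k).1) h).bddDerivs_corner_of_le
      (fun k => ?_) ιd ιs (h₁.mono inf_le_left) (h₂.mono inf_le_left)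
      (mem_inf_of_right (mem_principal_self S))
    obtain ⟨χ', A', hχ', hA', h'⟩ := (hA k).2
    exact ⟨χ', _, polyhomExpansion_x hχ' hA' h'⟩
  · obtain ⟨χ, A, hχ, hA, h⟩ := ha.1
    have := (polyhomExpansion_x hχ (fun k => (hA k).1) h).bddDerivs_corner_of_le
      (fun k => ?_) ιs ιd (h₂.mono inf_le_left) (h₁.mono inf_le_left)
      (l := l ⊓ 𝓟 Sᶜ) (mem_inf_of_right fun q hq =>
        (not_le.1 (show ¬ 1 - ‖π₂ q‖ ≤ 1 - ‖π₁ q‖ from hq)).le)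
    · simpa only [mul_comm] using this
    · obtain ⟨χ', A', hχ', hA', h'⟩ := (hA k).2
      exact ⟨χ', _, polyhomExpansion_theta hχ' hA' h'⟩

end Faces

/-! ### The derivative of the radial compactification -/

section RadialDerivative

variable {n : ℕ}

theorem hasFDerivAt_norm_of_ne_zero {x : Eu n} (hx : x ≠ 0) :
    HasFDerivAt (fun x : Eu n => ‖x‖) (innerSL ℝ (‖x‖⁻¹ • x)) x := by
  have h := (hasStrictFDerivAt_norm_sq x).hasFDerivAt.sqrt (by simpa using hx)
  simp only [Real.sqrt_sq (norm_nonneg _)] at h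
  refine h.congr_fderiv ?_
  ext v
  have : ‖x‖ ≠ 0 := norm_ne_zero_iff.2 hx
  simp
  field_simp

theorem RadialDiffeo.norm_toFun (ι : RadialDiffeo n) {x : Eu n} (hx : 3 < ‖x‖) :
    ‖ι.toFun x‖ = 1 - ‖x‖⁻¹ := by
  have h0 : 0 < ‖x‖ := by linarith
  have h1 : ‖x‖⁻¹ < 1 := inv_lt_one_of_one_lt₀ (by linarith)
  rw [ι.toFun_of_large x hx, norm_smul, norm_smul, one_div, norm_inv, norm_norm,
    inv_mul_cancel₀ h0.ne', mul_one, Real.norm_of_nonneg (by linarith)]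

/-- The value at `x = ι⁻¹ y` of `|x| Dι(x)`, in terms of the point `y`. It is smooth up to the unit
sphere. -/
noncomputable def radialDeriv (y : Eu n) : Eu n →L[ℝ] Eu n :=
  ‖y‖ • ContinuousLinearMap.id ℝ (Eu n) +
    (1 - 2 * ‖y‖) • (innerSL ℝ (‖y‖⁻¹ • y)).smulRight (‖y‖⁻¹ • y)

theorem contDiffAt_radialDeriv {y : Eu n} (hy : y ≠ 0) : ContDiffAt ℝ ∞ radialDeriv y := by
  have h1 : ContDiffAt ℝ ∞ (fun y : Eu n => ‖y‖) y := contDiffAt_norm ℝ hy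
  have h2 : ContDiffAt ℝ ∞ (fun y : Eu n => ‖y‖⁻¹ • y) y :=
    (h1.inv (norm_ne_zero_iff.2 hy)).smul contDiffAt_id
  exact (h1.smul contDiffAt_const).add ((contDiffAt_const.sub (contDiffAt_const.mul h1)).smul
    (((innerSL ℝ (E := Eu n)).contDiff.contDiffAt.comp y h2).smulRight h2))

theorem RadialDiffeo.norm_smul_fderiv (ι : RadialDiffeo n) {y : Eu n} (h1 : 2 / 3 < ‖y‖)
    (h2 : ‖y‖ < 1) :
    ‖ι.inv y‖ • fderiv ℝ ι.toFun (ι.inv y) = radialDeriv y := by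
  set x := ι.inv y with hx
  have hρ : 0 < 1 - ‖y‖ := by linarith
  have hnx : ‖x‖ = (1 - ‖y‖)⁻¹ := ι.norm_inv_eq h1 h2
  have h3 : 3 < ‖x‖ := by
    rw [hnx, lt_inv_comm₀ (by norm_num) hρ]
    norm_num
    linarith
  have hx0 : x ≠ 0 := norm_ne_zero_iff.1 (by linarith)
  have hne : ‖x‖ ≠ 0 := norm_ne_zero_iff.2 hx0
  have hdir : ‖x‖⁻¹ • x = ‖y‖⁻¹ • y := by
    rw [hnx, inv_inv, hx, ι.inv_eq h1 h2, smul_smul, mul_inv_cancel₀ hρ.ne', one_smul]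
  have heq : ι.toFun =ᶠ[𝓝 x] fun x' => (‖x'‖⁻¹ - ‖x'‖⁻¹ ^ 2) • x' := by
    filter_upwards [continuous_norm.continuousAt.eventually (lt_mem_nhds h3)] with x' hx'
    rw [ι.toFun_of_large x' hx', smul_smul]
    congr 1
    ring
  have hN := hasFDerivAt_norm_of_ne_zero hx0
  have hI : HasFDerivAt (fun x' : Eu n => ‖x'‖⁻¹) (-(‖x‖ ^ 2)⁻¹ • innerSL ℝ (‖x‖⁻¹ • x)) x :=
    (hasDerivAt_inv hne).comp_hasFDerivAt x hN
  have hc : HasFDerivAt (fun x' : Eu n => (‖x'‖⁻¹ - ‖x'‖⁻¹ ^ 2) • x') _ x :=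
    (hI.sub (hI.pow 2)).smul (hasFDerivAt_id x)
  rw [heq.fderiv_eq, hc.fderiv]
  have hy' : ‖y‖ = 1 - ‖x‖⁻¹ := by rw [hnx, inv_inv]; ring
  rw [radialDeriv, ← hdir, hy']
  ext1 v
  simp
  match_scalars
  · field_simp
  · field_simp
    ring

end RadialDerivative

/-! ### The partial gradient near the boundary -/

section Gradient

variable {d s : ℕ}

theorem isOpen_interior_domain : IsOpen (oball d ×ˢ oball s) :=
  Metric.isOpen_ball.prod Metric.isOpen_ball

theorem eventually_nhds_of_nhdsWithin {X : Type*} [TopologicalSpace X] {U : Set X} (hU : IsOpen U)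
    {p : X} {P : X → Prop} (h : ∀ᶠ q in 𝓝[U] p, P q) : ∀ᶠ q in 𝓝[U] p, ∀ᶠ q' in 𝓝 q, P q' := by
  filter_upwards [eventually_eventually_nhdsWithin.2 h, self_mem_nhdsWithin] with q hq hqU
  rwa [hU.nhdsWithin_eq hqU] at hq

theorem BddDerivs.congr_of_isOpen {E F : Type*} [NormedAddCommGroup E] [NormedSpace ℝ E]
    [NormedAddCommGroup F] [NormedSpace ℝ F] {U : Set E} (hU : IsOpen U) {p : E} {f g : E → F}
    (hf : BddDerivs (𝓝[U] p) f) (h : ∀ᶠ q in 𝓝[U] p, f q = g q) : BddDerivs (𝓝[U] p) g :=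
  hf.congr (eventually_nhds_of_nhdsWithin hU h)

/-- Transfer of bounds from the weighted pullback `F` of `φ` to the weighted pullback of the
differential `∂ₓ φ`, by the chain rule. The function `ρ` is the inverse of the weight in `x` that
occurs in `F`. -/
theorem bddDerivs_fderiv_of_pullback (ιd : RadialDiffeo d) (ιs : RadialDiffeo s)
    {φ : Eu d → Eu s → ℝ} {p : Eu d × Eu s} {F : Eu d × Eu s → ℝ} {σ : Eu s → ℝ} {ρ : Eu d → ℝ}
    {M : Eu d × Eu s → Eu d →L[ℝ] Eu d} {D : Eu d × Eu s → Eu d →L[ℝ] ℝ}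
    (hF : BddDerivs (𝓝[oball d ×ˢ oball s] p) F) (hM : BddDerivs (𝓝[oball d ×ˢ oball s] p) M)
    (hD : BddDerivs (𝓝[oball d ×ˢ oball s] p) D)
    (hρ : ∀ᶠ q in 𝓝[oball d ×ˢ oball s] p, HasFDerivAt ρ (D q) (ιd.inv q.1))
    (hι : ∀ᶠ q in 𝓝[oball d ×ˢ oball s] p,
      ρ (ιd.inv q.1) • fderiv ℝ ιd.toFun (ιd.inv q.1) = M q)
    (heq : ∀ᶠ q in 𝓝[oball d ×ˢ oball s] p, ∀ᶠ x in 𝓝 (ιd.inv q.1),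
      ρ x * F (ιd.toFun x, q.2) = σ q.2 * φ x (ιs.inv q.2))
    (hφ : ContDiff ℝ ∞ fun z : Eu d × Eu s => φ z.1 z.2) :
    BddDerivs (𝓝[oball d ×ˢ oball s] p)
      fun q => σ q.2 • fderiv ℝ (fun x => φ x (ιs.inv q.2)) (ιd.inv q.1) := by
  have h1 : BddDerivs (𝓝[oball d ×ˢ oball s] p) fun q =>
      (fderiv ℝ F q ∘L ContinuousLinearMap.inl ℝ (Eu d) (Eu s)) ∘L M q + F q • D q :=
    BddDerivs.add (BddDerivs.bilinear (ContinuousLinearMap.compL ℝ (Eu d) (Eu d) ℝ)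
      (BddDerivs.clm_comp ((ContinuousLinearMap.compL ℝ (Eu d) (Eu d × Eu s) ℝ).flip
        (ContinuousLinearMap.inl ℝ (Eu d) (Eu s))) hF.fderiv) hM) (hF.smul hD)
  refine h1.congr_of_isOpen isOpen_interior_domain ?_
  filter_upwards [hF.1, hρ, hι, heq, self_mem_nhdsWithin] with q h2 h3 h4 h5 hq
  have hq1 : ιd.toFun (ιd.inv q.1) = q.1 := ιd.toFun_inv _ hq.1
  have hι' : HasFDerivAt ιd.toFun (fderiv ℝ ιd.toFun (ιd.inv q.1)) (ιd.inv q.1) :=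
    (ιd.contDiff_toFun.contDiffAt.differentiableAt (by simp)).hasFDerivAt
  have hF' : HasFDerivAt F (fderiv ℝ F q) (ιd.toFun (ιd.inv q.1), q.2) := by
    rw [hq1]
    exact (h2.differentiableAt (by simp)).hasFDerivAt
  have h6 : HasFDerivAt (fun x => F (ιd.toFun x, q.2)) _ (ιd.inv q.1) :=
    hF'.comp (ιd.inv q.1) (hι'.prodMk (hasFDerivAt_const q.2 (ιd.inv q.1)))
  have h7 := (h3.mul h6).congr_of_eventuallyEq (h5.mono fun x hx => hx.symm)
  have h8 : DifferentiableAt ℝ (fun x => φ x (ιs.inv q.2)) (ιd.inv q.1) :=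
    (hφ.comp (contDiff_id.prodMk contDiff_const)).contDiffAt.differentiableAt (by simp)
  have h9 := h7.unique (h8.hasFDerivAt.const_mul (σ q.2))
  rw [← h9, ← h4, hq1]
  ext v
  simp

/-- The Riesz isomorphism from the dual to the space, as a real linear map. -/
noncomputable def rieszL (d : ℕ) : (Eu d →L[ℝ] ℝ) →L[ℝ] Eu d :=
  LinearMap.toContinuousLinearMap
    { toFun := fun L => (InnerProductSpace.toDual ℝ (Eu d)).symm L
      map_add' := fun L L' => map_add _ L L'
      map_smul' := fun c L => by simp }

theorem gradX_eq_rieszL (φ : Eu d → Eu s → ℝ) (x : Eu d) (θ : Eu s) :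
    gradX φ x θ = rieszL d (fderiv ℝ (fun x' => φ x' θ) x) := rfl

theorem approachesSphere_fst {p : Eu d × Eu s} (hp : p.1 ∈ usphere d) :
    ApproachesSphere (𝓝[oball d ×ˢ oball s] p) (ContinuousLinearMap.fst ℝ (Eu d) (Eu s)) p :=
  ⟨nhdsWithin_le_nhds, by simpa using hp, by
    filter_upwards [self_mem_nhdsWithin] with q hq using by simpa using hq.1⟩

theorem approachesSphere_snd {p : Eu d × Eu s} (hp : p.2 ∈ usphere s) :
    ApproachesSphere (𝓝[oball d ×ˢ oball s] p) (ContinuousLinearMap.snd ℝ (Eu d) (Eu s)) p :=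
  ⟨nhdsWithin_le_nhds, by simpa using hp, by
    filter_upwards [self_mem_nhdsWithin] with q hq using by simpa using hq.2⟩

theorem RadialDiffeo.contDiffAt_inv {n : ℕ} (ι : RadialDiffeo n) {y : Eu n} (hy : y ∈ oball n) :
    ContDiffAt ℝ ∞ ι.inv y :=
  ι.contDiffOn_inv.contDiffAt (Metric.isOpen_ball.mem_nhds hy)

theorem eventually_contDiffAt_inv_fst (ιd : RadialDiffeo d) {p : Eu d × Eu s}
    (hp : p.1 ∈ oball d) : ∀ᶠ q in 𝓝 p, ContDiffAt ℝ ∞ (fun q : Eu d × Eu s => ιd.inv q.1) q := by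
  filter_upwards [continuous_fst.continuousAt.eventually (Metric.isOpen_ball.mem_nhds hp)] with q hq
  exact (ιd.contDiffAt_inv hq).comp q contDiffAt_fst

theorem eventually_contDiffAt_inv_snd (ιs : RadialDiffeo s) {p : Eu d × Eu s}
    (hp : p.2 ∈ oball s) : ∀ᶠ q in 𝓝 p, ContDiffAt ℝ ∞ (fun q : Eu d × Eu s => ιs.inv q.2) q := by
  filter_upwards [continuous_snd.continuousAt.eventually (Metric.isOpen_ball.mem_nhds hp)] with q hq
  exact (ιs.contDiffAt_inv hq).comp q contDiffAt_snd

theorem bddDerivs_smul_gradX_of_mem_oball (ιd : RadialDiffeo d) (ιs : RadialDiffeo s)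
    {φ : Eu d → Eu s → ℝ} (hφ : ContDiff ℝ ∞ fun z : Eu d × Eu s => φ z.1 z.2) {σ : Eu s → ℝ}
    {p : Eu d × Eu s} (hp : p.1 ∈ oball d)
    (hF : BddDerivs (𝓝[oball d ×ˢ oball s] p)
      fun q => σ q.2 * φ (ιd.inv q.1) (ιs.inv q.2)) :
    BddDerivs (𝓝[oball d ×ˢ oball s] p)
      fun q => σ q.2 • gradX φ (ιd.inv q.1) (ιs.inv q.2) := by
  have hinv := eventually_contDiffAt_inv_fst (s := s) ιd hp
  have h := bddDerivs_fderiv_of_pullback ιd ιs (σ := σ) (ρ := fun _ => 1) (D := fun _ => 0)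
    (M := fun q => fderiv ℝ ιd.toFun (ιd.inv q.1)) hF ?_ (BddDerivs.const _ _) ?_ ?_ ?_ hφ
  · simpa only [gradX_eq_rieszL, map_smul] using h.clm_comp (rieszL d)
  · exact BddDerivs.of_contDiffAt nhdsWithin_le_nhds (hinv.mono fun q hq =>
      (ιd.contDiff_toFun.fderiv_right (m := ∞) (by simp)).contDiffAt.comp q hq)
  · exact Eventually.of_forall fun q => hasFDerivAt_const _ _
  · exact Eventually.of_forall fun q => one_smul _ _
  · exact Eventually.of_forall fun q => Eventually.of_forall fun x => by
      simp only [ιd.inv_toFun, one_mul]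

/-- Where `|y| = 1`, the pullback of `φ` carries the weight `1 - |y| = 1 / |x|` but that of `∇ₓφ`
carries none: the factor `|x|` is compensated by the decay of `Dι(x)`. -/
theorem bddDerivs_smul_gradX_of_mem_usphere (ιd : RadialDiffeo d) (ιs : RadialDiffeo s)
    {φ : Eu d → Eu s → ℝ} (hφ : ContDiff ℝ ∞ fun z : Eu d × Eu s => φ z.1 z.2) {σ : Eu s → ℝ}
    {p : Eu d × Eu s} (hp : p.1 ∈ usphere d)
    (hF : BddDerivs (𝓝[oball d ×ˢ oball s] p)
      fun q => (1 - ‖q.1‖) * σ q.2 * φ (ιd.inv q.1) (ιs.inv q.2)) :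
    BddDerivs (𝓝[oball d ×ˢ oball s] p)
      fun q => σ q.2 • gradX φ (ιd.inv q.1) (ιs.inv q.2) := by
  have hA := approachesSphere_fst (s := s) hp
  have hev := hA.eventually (ε := 1 / 3) (by norm_num)
  simp only [ContinuousLinearMap.coe_fst'] at hev
  have h3 : ∀ y : Eu d, 1 - 1 / 3 < ‖y‖ → ‖y‖ < 1 → 3 < ‖ιd.inv y‖ := fun y h1 h2 => by
    rw [ιd.norm_inv_eq (by linarith) h2, lt_inv_comm₀ (by norm_num) (by linarith)]
    norm_num
    linarith
  have h := bddDerivs_fderiv_of_pullback ιd ιs (σ := σ) (ρ := fun x => ‖x‖)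
    (D := fun q => innerSL ℝ (‖q.1‖⁻¹ • q.1)) (M := fun q => radialDeriv q.1) hF ?_ ?_ ?_ ?_ ?_ hφ
  · simpa only [gradX_eq_rieszL, map_smul] using h.clm_comp (rieszL d)
  · exact BddDerivs.of_contDiffAt nhdsWithin_le_nhds (hA.ne_zero_near.mono fun q hq =>
      (contDiffAt_radialDeriv hq).comp q contDiffAt_fst)
  · exact BddDerivs.clm_comp (innerSL ℝ (E := Eu d))
      (BddDerivs.of_contDiffAt hA.le_nhds hA.contDiffAt_direction_near)
  · filter_upwards [hev] with q hq
    have h4 := h3 q.1 hq.1 hq.2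
    have h5 : ιd.inv q.1 ≠ 0 := norm_ne_zero_iff.1 (by linarith)
    have h6 : ‖ιd.inv q.1‖⁻¹ • ιd.inv q.1 = ‖q.1‖⁻¹ • q.1 := by
      have : 1 - ‖q.1‖ ≠ 0 := by linarith
      rw [ιd.norm_inv_eq (by linarith) hq.2, inv_inv, ιd.inv_eq (by linarith) hq.2, smul_smul,
        mul_inv_cancel₀ this, one_smul]
    simpa only [h6] using hasFDerivAt_norm_of_ne_zero h5
  · filter_upwards [hev] with q hq using ιd.norm_smul_fderiv (by linarith) hq.2
  · filter_upwards [hev] with q hq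
    filter_upwards [continuous_norm.continuousAt.eventually
      (lt_mem_nhds (h3 q.1 hq.1 hq.2))] with x hx
    have : ‖x‖ ≠ 0 := by linarith
    rw [ιd.inv_toFun, ιd.norm_toFun hx]
    field_simp
    ring

end Gradient

/-! ### Extension of the map `λ_φ` -/

section Main

variable {d s : ℕ}

theorem mem_closure_interior {p : Eu d × Eu s} (h1 : p.1 ∈ cball d) (h2 : p.2 ∈ cball s) :
    p ∈ closure (oball d ×ˢ oball s) := by
  rw [closure_prod_eq, closure_ball _ one_ne_zero, closure_ball _ one_ne_zero]
  exact ⟨h1, h2⟩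

theorem mem_closure_of_mem_extDomain {ιd : RadialDiffeo d} {ιs : RadialDiffeo s}
    {hd : BoundaryFn d} {hs : BoundaryFn s} {φ : Eu d → Eu s → ℝ} {p : Eu d × Eu s}
    (hp : p ∈ extDomain ιd ιs hd hs φ) : p ∈ closure (oball d ×ˢ oball s) := by
  have hb : ∀ n, oball n ⊆ cball n := fun n => Metric.ball_subset_closedBall
  have hsp : ∀ n, usphere n ⊆ cball n := fun n => Metric.sphere_subset_closedBall
  rcases hp with (hp | hp) | ⟨hp | hp, -⟩
  · exact subset_closure hp
  · exact mem_closure_interior (hsp _ hp.1) (hb _ hp.2)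
  · exact mem_closure_interior (hb _ hp.1) (hsp _ hp.2)
  · exact mem_closure_interior (hsp _ hp.1) (hsp _ hp.2)

theorem IsSGClassical.contDiff {m r : ℝ} {φ : Eu d → Eu s → ℝ} (hφ : IsSGClassical m r φ) :
    ContDiff ℝ ∞ fun z : Eu d × Eu s => φ z.1 z.2 := by
  obtain ⟨χ, A, -, -, h⟩ := hφ.1
  simpa using (h 0).1

variable {φ : Eu d → Eu s → ℝ}

theorem bddDerivs_gradX_faceE (hφ : IsSGClassical 1 1 φ) (ιd : RadialDiffeo d)
    (ιs : RadialDiffeo s) {p : Eu d × Eu s} (hp : p ∈ faceE d s) :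
    BddDerivs (𝓝[oball d ×ˢ oball s] p) fun q => gradX φ (ιd.inv q.1) (ιs.inv q.2) := by
  have h := hφ.bddDerivs_x ιd (approachesSphere_fst hp.1) (eventually_contDiffAt_inv_snd ιs hp.2)
  simpa using bddDerivs_smul_gradX_of_mem_usphere ιd ιs hφ.contDiff (σ := fun _ => 1) hp.1
    (by simpa using h)

theorem bddDerivs_smul_gradX (hφ : IsSGClassical 1 1 φ) (ιd : RadialDiffeo d)
    (ιs : RadialDiffeo s) {p : Eu d × Eu s} (hp : p ∈ facePsi d s ∪ facePsiE d s) :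
    BddDerivs (𝓝[oball d ×ˢ oball s] p)
      fun q => (1 - ‖q.2‖) • gradX φ (ιd.inv q.1) (ιs.inv q.2) := by
  rcases hp with hp | hp
  · have h := hφ.bddDerivs_theta ιs (approachesSphere_snd hp.2)
      (eventually_contDiffAt_inv_fst ιd hp.1)
    exact bddDerivs_smul_gradX_of_mem_oball ιd ιs hφ.contDiff (σ := fun γ => 1 - ‖γ‖) hp.1
      (by simpa using h)
  · have h := hφ.bddDerivs_corner ιd ιs (approachesSphere_fst hp.1) (approachesSphere_snd hp.2)
    exact bddDerivs_smul_gradX_of_mem_usphere ιd ιs hφ.contDiff (σ := fun γ => 1 - ‖γ‖) hp.1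
      (by simpa using h)

/-- Ellipticity of `|∇ₓφ|²` at `p` means that the rescaled gradient has a nonzero limit there. -/
theorem ne_zero_of_isEllipticAt {ιd : RadialDiffeo d} {ιs : RadialDiffeo s} {hd : BoundaryFn d}
    {hs : BoundaryFn s} {p : Eu d × Eu s} (hp : p ∈ closure (oball d ×ˢ oball s))
    (hp2 : p.2 ∈ usphere s) {v : Eu d}
    (hv : Tendsto (fun q => (1 - ‖q.2‖) • gradX φ (ιd.inv q.1) (ιs.inv q.2))
      (𝓝[oball d ×ˢ oball s] p) (𝓝 v))
    (hell : IsEllipticAt ιd ιs hd hs 0 2 (fun x θ => ‖gradX φ x θ‖ ^ 2) p) : v ≠ 0 := by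
  rintro rfl
  refine hell (extendFrom_eq hp ?_)
  have h := (hv.norm.pow 2)
  rw [norm_zero, zero_pow two_ne_zero] at h
  refine h.congr' ?_
  filter_upwards [(approachesSphere_snd (d := d) hp2).eventually (ε := 1 / 3) (by norm_num)]
    with q hq
  simp only [ContinuousLinearMap.coe_snd'] at hq
  have hball : q.2 ∈ cball s := by simpa using hq.2.le
  rw [weightedPullback, hs.h_eq_norm _ hball (by linarith), Real.rpow_zero, Real.rpow_two,
    norm_smul, mul_pow, Real.norm_eq_abs, sq_abs, one_mul]

/-- In the region where `∇ₓφ` is large, `ι(∇ₓφ)` is a smooth function of the rescaled gradient `W`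
and of the boundary defining function `σ`, namely `(1 - σ / |W|) W / |W|`. -/
theorem bddDerivs_toFun_gradX (ιd : RadialDiffeo d) (ιs : RadialDiffeo s) {p : Eu d × Eu s}
    (hp2 : p.2 ∈ usphere s) {v : Eu d} (hv0 : v ≠ 0)
    (hb : BddDerivs (𝓝[oball d ×ˢ oball s] p)
      fun q => (1 - ‖q.2‖) • gradX φ (ιd.inv q.1) (ιs.inv q.2))
    (hv : Tendsto (fun q => (1 - ‖q.2‖) • gradX φ (ιd.inv q.1) (ιs.inv q.2))
      (𝓝[oball d ×ˢ oball s] p) (𝓝 v)) :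
    BddDerivs (𝓝[oball d ×ˢ oball s] p)
      fun q => ιd.toFun (gradX φ (ιd.inv q.1) (ιs.inv q.2)) := by
  have hA := approachesSphere_snd (d := d) hp2
  have hσ : BddDerivs (𝓝[oball d ×ˢ oball s] p) fun q : Eu d × Eu s => 1 - ‖q.2‖ :=
    hA.bddDerivs_one_sub
  have hσ0 : Tendsto (fun q : Eu d × Eu s => 1 - ‖q.2‖) (𝓝[oball d ×ˢ oball s] p) (𝓝 0) := by
    have hc : Continuous fun q : Eu d × Eu s => 1 - ‖q.2‖ := by fun_prop
    have h1 : ‖p.2‖ = 1 := by simpa using hp2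
    simpa [h1] using (hc.tendsto p).mono_left nhdsWithin_le_nhds
  have hΨ : ∀ᶠ z : Eu d × ℝ in 𝓝 (v, 0),
      ContDiffAt ℝ ∞ (fun z : Eu d × ℝ => (1 - z.2 * ‖z.1‖⁻¹) • (‖z.1‖⁻¹ • z.1)) z := by
    filter_upwards [continuous_fst.continuousAt.eventually_ne (y := (0 : Eu d))
      (x := ((v, 0) : Eu d × ℝ)) hv0] with z hz
    have h1 : ContDiffAt ℝ ∞ (fun z : Eu d × ℝ => ‖z.1‖⁻¹) z :=
      ((contDiffAt_norm ℝ hz).comp z contDiffAt_fst).inv (norm_ne_zero_iff.2 hz)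
    exact (contDiffAt_const.sub (contDiffAt_snd.mul h1)).smul (h1.smul contDiffAt_fst)
  have h := (hb.prodMk hσ).comp (hv.prodMk_nhds hσ0) hΨ
  refine h.congr_of_isOpen isOpen_interior_domain ?_
  have hv' : 0 < ‖v‖ := norm_pos_iff.2 hv0
  filter_upwards [hA.norm_lt_one, hv.norm.eventually (lt_mem_nhds (half_lt_self hv')),
    hσ0.eventually (gt_mem_nhds (show 0 < ‖v‖ / 6 by positivity))] with q h1 h2 h3
  simp only [ContinuousLinearMap.coe_snd'] at h1
  have hpos : 0 < 1 - ‖q.2‖ := by linarith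
  set g := gradX φ (ιd.inv q.1) (ιs.inv q.2) with hg
  rw [norm_smul, Real.norm_of_nonneg hpos.le] at h2
  have hlarge : 3 < ‖g‖ := by
    by_contra! hle
    nlinarith
  have hne : ‖g‖ ≠ 0 := by linarith
  rw [ιd.toFun_of_large _ hlarge]
  simp only [Function.comp_apply, ← hg, norm_smul, Real.norm_of_nonneg hpos.le, smul_smul]
  congr 1
  field_simp

theorem lambdaTilde_mem (ιd : RadialDiffeo d) (ιs : RadialDiffeo s)
    (q : Eu d × Eu s) : lambdaTilde ιd ιs φ q ∈ cball d ×ˢ cball d :=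
  ⟨Metric.ball_subset_closedBall (ιd.toFun_mem _), Metric.ball_subset_closedBall (ιd.toFun_mem _)⟩

theorem bddDerivs_lambdaTilde_of_snd {ιd : RadialDiffeo d} {ιs : RadialDiffeo s}
    {p : Eu d × Eu s} (h : BddDerivs (𝓝[oball d ×ˢ oball s] p)
      fun q => ιd.toFun (gradX φ (ιd.inv q.1) (ιs.inv q.2))) :
    BddDerivs (𝓝[oball d ×ˢ oball s] p) (lambdaTilde ιd ιs φ) := by
  have h1 : BddDerivs (𝓝[oball d ×ˢ oball s] p) (Prod.fst : Eu d × Eu s → Eu d) :=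
    BddDerivs.of_contDiffAt nhdsWithin_le_nhds (Eventually.of_forall fun _ => contDiffAt_fst)
  refine (h1.prodMk h).congr_of_isOpen isOpen_interior_domain ?_
  filter_upwards [self_mem_nhdsWithin] with q hq
  exact Prod.ext (ιd.toFun_inv _ hq.1).symm rfl

theorem contDiff_gradX (hφ : ContDiff ℝ ∞ fun z : Eu d × Eu s => φ z.1 z.2) :
    ContDiff ℝ ∞ fun z : Eu d × Eu s => gradX φ z.1 z.2 := by
  have h : ∀ z : Eu d × Eu s, fderiv ℝ (fun x => φ x z.2) z.1 =
      (fderiv ℝ (fun z : Eu d × Eu s => φ z.1 z.2) z) ∘L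
        ContinuousLinearMap.inl ℝ (Eu d) (Eu s) := fun z =>
    ((hφ.contDiffAt.differentiableAt (by simp)).hasFDerivAt.comp z.1
      ((hasFDerivAt_id z.1).prodMk (hasFDerivAt_const z.2 z.1))).fderiv
  simp only [gradX_eq_rieszL, h]
  exact (rieszL d).contDiff.comp ((hφ.fderiv_right (m := ∞) (by simp)).clm_comp contDiff_const)

/-- On the interior and on the face at `|y| = 1` the gradient itself has a limit, to which `ι`
applies; at elliptic points only the rescaled gradient does. -/
theorem bddDerivs_lambdaTilde (hφ : IsSGClassical 1 1 φ) {ιd : RadialDiffeo d}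
    {ιs : RadialDiffeo s} {hd : BoundaryFn d} {hs : BoundaryFn s} {p : Eu d × Eu s}
    (hp : p ∈ extDomain ιd ιs hd hs φ) :
    BddDerivs (𝓝[oball d ×ˢ oball s] p) (lambdaTilde ιd ιs φ) := by
  have hcl := mem_closure_of_mem_extDomain hp
  have hconv : Convex ℝ (oball d ×ˢ oball s) := (convex_ball _ _).prod (convex_ball _ _)
  have hι : ∀ z, ContDiffAt ℝ ∞ ιd.toFun z := fun z => ιd.contDiff_toFun.contDiffAt
  refine bddDerivs_lambdaTilde_of_snd ?_
  rcases hp with (hp | hp) | ⟨hp, hell⟩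
  · refine BddDerivs.of_contDiffAt nhdsWithin_le_nhds ?_
    filter_upwards [eventually_contDiffAt_inv_fst ιd hp.1,
      eventually_contDiffAt_inv_snd ιs hp.2] with q h1 h2
    exact (ιd.contDiff_toFun.comp (contDiff_gradX hφ.contDiff)).contDiffAt.comp q (h1.prodMk h2)
  · have hb := bddDerivs_gradX_faceE hφ ιd ιs hp
    obtain ⟨v, hv⟩ := hb.exists_tendsto isOpen_interior_domain hconv hcl
    exact hb.comp hv (Eventually.of_forall hι)
  · have hp2 : p.2 ∈ usphere s := hp.elim (fun h => h.2) fun h => h.2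
    have hb := bddDerivs_smul_gradX hφ ιd ιs hp
    obtain ⟨v, hv⟩ := hb.exists_tendsto isOpen_interior_domain hconv hcl
    exact bddDerivs_toFun_gradX ιd ιs hp2 (ne_zero_of_isEllipticAt hcl hp2 hv hell) hb hv

end Main

end SGPhase

theorem mainTheorem6 (d s : ℕ)
    (ιd : SGPhase.RadialDiffeo d) (ιs : SGPhase.RadialDiffeo s)
    (hd : SGPhase.BoundaryFn d) (hs : SGPhase.BoundaryFn s)
    (φ : SGPhase.Eu d → SGPhase.Eu s → ℝ) (hφ : SGPhase.IsClassicalPhase φ) :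
    ∃ L : SGPhase.Eu d × SGPhase.Eu s → SGPhase.Eu d × SGPhase.Eu d,
      ContDiffOn ℝ ∞ L (SGPhase.extDomain ιd ιs hd hs φ) ∧
      Set.MapsTo L (SGPhase.extDomain ιd ιs hd hs φ) (SGPhase.cball d ×ˢ SGPhase.cball d) ∧
      Set.EqOn L (SGPhase.lambdaTilde ιd ιs φ) (SGPhase.oball d ×ˢ SGPhase.oball s) := by
  have hU := SGPhase.isOpen_interior_domain (d := d) (s := s)
  have hconv : Convex ℝ (SGPhase.oball d ×ˢ SGPhase.oball s) :=
    (convex_ball _ _).prod (convex_ball _ _)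
  refine ⟨extendFrom (SGPhase.oball d ×ˢ SGPhase.oball s) (SGPhase.lambdaTilde ιd ιs φ),
    fun p hp => ?_, fun p hp => ?_, fun p hp => ?_⟩
  · have hcl := SGPhase.mem_closure_of_mem_extDomain hp
    exact ((SGPhase.bddDerivs_lambdaTilde hφ.1 hp).contDiffWithinAt_extendFrom hU hconv hcl).mono
      fun q hq => SGPhase.mem_closure_of_mem_extDomain hq
  · have hcl := SGPhase.mem_closure_of_mem_extDomain hp
    have hne : (𝓝[SGPhase.oball d ×ˢ SGPhase.oball s] p).NeBot :=
      mem_closure_iff_nhdsWithin_neBot.1 hcl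
    have hlim := (SGPhase.bddDerivs_lambdaTilde hφ.1 hp).exists_tendsto hU hconv hcl
    exact (Metric.isClosed_closedBall.prod Metric.isClosed_closedBall).mem_of_tendsto
      (tendsto_extendFrom hlim)
      (Eventually.of_forall (SGPhase.lambdaTilde_mem ιd ιs))
  · have hp' : p ∈ SGPhase.extDomain ιd ιs hd hs φ := Or.inl (Or.inl hp)
    have h := (SGPhase.bddDerivs_lambdaTilde hφ.1 hp').1
    rw [hU.nhdsWithin_eq hp] at h
    exact extendFrom_eq (subset_closure hp) h.self_of_nhds.continuousAt.continuousWithinAt
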